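/- Let $a,z$ be commuting variables, $F=\mathbb{C}(a,z)$, and put $x=\dfrac{z}{a+a^{-1}-z}\in F$, $y=(a+a^{-1})z^{-1}-1$. For $n\ge 1$ let $\mathcal{C}_n=\mathcal{C}_n(\ell,m)$, with $\ell=a$, $m=z$, be the BMW algebra: the unital associative $F$-algebra generated by invertible elements $G_1,\dots,G_{n-1}$ and elements $H_1,\dots,H_{n-1}$ subject to $G_iG_j=G_jG_i$ for $|i-j|>1$; $G_iG_jG_i=G_jG_iG_j$ and $H_iG_jH_i=\ell H_i$ for $|i-j|=1$; $G_iH_i=\ell^{-1}H_i$ and $G_i+G_i^{-1}=m(1+H_i)$ for all $i$. Let $\mathcal{K}_n=\mathcal{K}_n(x,z,a)$ be the tied BMW algebra, specialized at the above value of $x$: the unital associative $F$-algebra generated by invertible elements $g_i$ and elements $e_i,h_i,f_i$ ($1\le i\le n-1$) subject to - for $|i-j|>1$: $g_ig_j=g_jg_i$, $h_ih_j=h_jh_i$, $g_ih_j=h_jg_i$, $e_ig_j=g_je_i$, $e_ih_j=h_je_i$; - for all $i$: $h_i^2=x^{-1}h_i$, $g_ih_i=h_ig_i=a^{-1}h_i$,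 $e_i^2=e_i$, $e_ig_i=g_ie_i$, $e_ih_i=h_ie_i=h_i$, $f_ie_i=e_if_i=f_i$, $f_ig_i=g_if_i=a^{-1}f_i$, $g_i+g_i^{-1}=z(e_i+f_i)$; and $e_ie_j=e_je_i$ for all $i,j$; - for $|i-j|=1$: $g_ig_jg_i=g_jg_ig_j$, $h_ig_jh_i=ah_i$, $h_ih_jh_i=h_i$, $g_ig_jh_i=h_jg_ig_j=h_jh_i$, $g_ih_jg_i=g_j^{-1}h_ig_j^{-1}$, $g_ih_jh_i=g_j^{-1}h_i$, $h_ih_jg_i=h_ig_j^{-1}$, $e_ie_jg_i=g_ie_ie_j=e_jg_ie_j$, $e_ig_jg_i=g_jg_ie_j$, $f_ie_j=e_jf_i=e_jh_ie_j$, $g_if_jg_i=g_j^{-1}f_ig_j^{-1}$. (For $n=1$ both algebras are $F$.) Elements of $\mathcal{K}_n$ and $\mathcal{C}_n$ are regarded as elements of $\mathcal{K}_{n+1}$ and $\mathcal{C}_{n+1}$ by means of the natural homomorphisms that send each generator to the generator with the same name. A Markov trace on the BMW algebras is a family of $F$-linear maps $\tau'_n:\mathcal{C}_n\to F$ ($n\ge1$)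 with $\tau'_n(1)=1$, $\tau'_n(cd)=\tau'_n(dc)$, $\tau'_{n+1}(cG_n)=\dfrac{m\ell}{\ell+\ell^{-1}-m}\,\tau'_n(c)$ and $\tau'_{n+1}(cH_n)=\dfrac{m}{\ell+\ell^{-1}-m}\,\tau'_n(c)$ for all $c,d\in\mathcal{C}_n$. A Markov trace on the tied BMW algebras is a family of $F$-linear maps $\varpi_n:\mathcal{K}_n\to F$ ($n\ge1$) with $\varpi_n(1)=1$, $\varpi_n(\alpha\beta)=\varpi_n(\beta\alpha)$, $\varpi_{n+1}(\alpha g_n)=\varpi_{n+1}(\alpha g_ne_n)=xa\,\varpi_n(\alpha)$, $\varpi_{n+1}(\alpha h_n)=\varpi_{n+1}(\alpha f_n)=x\,\varpi_n(\alpha)$ and $\varpi_{n+1}(\alpha e_n)=xy\,\varpi_n(\alpha)$ for all $\alpha,\beta\in\mathcal{K}_n$. **Proposition.** For every $n\ge1$ the assignments $g_i\mapsto G_i$, $e_i\mapsto1$, $h_i\mapsto H_i$, $f_i\mapsto H_i$ define a unique homomorphism of $F$-algebras $\psi_n:\mathcal{K}_n\to\mathcal{C}_n$, and $\psi_n$ is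 surjective. Moreover, if $\tau'=\{\tau'_n\}$ is the Markov trace on the BMW algebras, then $\{\tau'_n\circ\psi_n\}$ is a Markov trace on the tied BMW algebras, and $\tau'_n\circ\psi_n=\varpi_n$ for every $n\ge 1$ and every Markov trace $\varpi=\{\varpi_n\}$ on the tied BMW algebras. -/

import Mathlib

noncomputable section

namespace TiedBMW

/-- `Far i j` is the condition `|i - j| > 1`. -/
def Far {n : ℕ} (i j : Fin n) : Prop := (i : ℕ) + 1 < j ∨ (j : ℕ) + 1 < i

/-- `Near i j` is the condition `|i - j| = 1`. -/
def Near {n : ℕ} (i j : Fin n) : Prop := (i : ℕ) + 1 = j ∨ (j : ℕ) + 1 = i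

/-! ### The tied BMW algebra

All algebras are indexed by the number `n` of generators of each kind, that is, by the number of
strands minus one: `TBMW x z a n` is the t-BMW algebra on `n + 1` strands. The generator with
index `i : Fin n` is the one with index `i + 1` in the usual numbering. -/

/-- Generators of the tied BMW algebra: braid generators and their inverses, ties, tangles and
tied tangles. -/
inductive TGen (n : ℕ) : Type
  | g (i : Fin n)
  | gInv (i : Fin n)
  | e (i : Fin n)
  | h (i : Fin n)
  | f (i : Fin n)

namespace TGen

/-- The inclusion of generators obtained by adding a strand on the right. -/
def castSucc {n : ℕ} : TGen n → TGen (n + 1)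
  | g i => g i.castSucc
  | gInv i => gInv i.castSucc
  | e i => e i.castSucc
  | h i => h i.castSucc
  | f i => f i.castSucc

end TGen

section TFree

variable (F : Type*) [Field F] {n : ℕ}

/-- The free generators. -/
abbrev fg (i : Fin n) : FreeAlgebra F (TGen n) := FreeAlgebra.ι F (TGen.g i)
abbrev fgInv (i : Fin n) : FreeAlgebra F (TGen n) := FreeAlgebra.ι F (TGen.gInv i)
abbrev fe (i : Fin n) : FreeAlgebra F (TGen n) := FreeAlgebra.ι F (TGen.e i)
abbrev fh (i : Fin n) : FreeAlgebra F (TGen n) := FreeAlgebra.ι F (TGen.h i)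
abbrev ff (i : Fin n) : FreeAlgebra F (TGen n) := FreeAlgebra.ι F (TGen.f i)

end TFree

/-- The defining relations of the tied BMW algebra with parameters `x, z, a`. -/
inductive TRel {F : Type*} [Field F] (x z a : F) (n : ℕ) :
    FreeAlgebra F (TGen n) → FreeAlgebra F (TGen n) → Prop
  -- the `gInv i` are the inverses of the `g i`
  | g_gInv (i : Fin n) : TRel x z a n (fg F i * fgInv F i) 1
  | gInv_g (i : Fin n) : TRel x z a n (fgInv F i * fg F i) 1
  -- braid relations
  | g_comm (i j : Fin n) (hij : Far i j) : TRel x z a n (fg F i * fg F j) (fg F j * fg F i)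
  | g_braid (i j : Fin n) (hij : Near i j) :
      TRel x z a n (fg F i * fg F j * fg F i) (fg F j * fg F i * fg F j)
  -- BMW relations
  | h_sq (i : Fin n) : TRel x z a n (fh F i * fh F i) (x⁻¹ • fh F i)
  | h_comm (i j : Fin n) (hij : Far i j) : TRel x z a n (fh F i * fh F j) (fh F j * fh F i)
  | gh_comm (i j : Fin n) (hij : Far i j) : TRel x z a n (fg F i * fh F j) (fh F j * fg F i)
  | gh_self (i : Fin n) : TRel x z a n (fg F i * fh F i) (a⁻¹ • fh F i)
  | hg_self (i : Fin n) : TRel x z a n (fh F i * fg F i) (a⁻¹ • fh F i)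
  | hgh (i j : Fin n) (hij : Near i j) : TRel x z a n (fh F i * fg F j * fh F i) (a • fh F i)
  | hhh (i j : Fin n) (hij : Near i j) : TRel x z a n (fh F i * fh F j * fh F i) (fh F i)
  | ggh (i j : Fin n) (hij : Near i j) :
      TRel x z a n (fg F i * fg F j * fh F i) (fh F j * fg F i * fg F j)
  | hgg (i j : Fin n) (hij : Near i j) :
      TRel x z a n (fh F j * fg F i * fg F j) (fh F j * fh F i)
  | ghg (i j : Fin n) (hij : Near i j) :
      TRel x z a n (fg F i * fh F j * fg F i) (fgInv F j * fh F i * fgInv F j)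
  | ghh (i j : Fin n) (hij : Near i j) :
      TRel x z a n (fg F i * fh F j * fh F i) (fgInv F j * fh F i)
  | hhg (i j : Fin n) (hij : Near i j) :
      TRel x z a n (fh F i * fh F j * fg F i) (fh F i * fgInv F j)
  -- tied braid relations
  | e_comm (i j : Fin n) : TRel x z a n (fe F i * fe F j) (fe F j * fe F i)
  | e_sq (i : Fin n) : TRel x z a n (fe F i * fe F i) (fe F i)
  | eg_self (i : Fin n) : TRel x z a n (fe F i * fg F i) (fg F i * fe F i)
  | eg_far (i j : Fin n) (hij : Far i j) : TRel x z a n (fe F i * fg F j) (fg F j * fe F i)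
  | eeg (i j : Fin n) (hij : Near i j) :
      TRel x z a n (fe F i * fe F j * fg F i) (fg F i * fe F i * fe F j)
  | gee (i j : Fin n) (hij : Near i j) :
      TRel x z a n (fg F i * fe F i * fe F j) (fe F j * fg F i * fe F j)
  | egg (i j : Fin n) (hij : Near i j) :
      TRel x z a n (fe F i * fg F j * fg F i) (fg F j * fg F i * fe F j)
  -- relations between ties, tangles and tied tangles
  | eh_self (i : Fin n) : TRel x z a n (fe F i * fh F i) (fh F i)
  | he_self (i : Fin n) : TRel x z a n (fh F i * fe F i) (fh F i)
  | eh_far (i j : Fin n) (hij : Far i j) : TRel x z a n (fe F i * fh F j) (fh F j * fe F i)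
  | fe_self (i : Fin n) : TRel x z a n (ff F i * fe F i) (ff F i)
  | ef_self (i : Fin n) : TRel x z a n (fe F i * ff F i) (ff F i)
  | fe_near (i j : Fin n) (hij : Near i j) : TRel x z a n (ff F i * fe F j) (fe F j * ff F i)
  | ef_near (i j : Fin n) (hij : Near i j) :
      TRel x z a n (fe F j * ff F i) (fe F j * fh F i * fe F j)
  | fg_self (i : Fin n) : TRel x z a n (ff F i * fg F i) (a⁻¹ • ff F i)
  | gf_self (i : Fin n) : TRel x z a n (fg F i * ff F i) (a⁻¹ • ff F i)
  | gfg (i j : Fin n) (hij : Near i j) :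
      TRel x z a n (fg F i * ff F j * fg F i) (fgInv F j * ff F i * fgInv F j)
  | skein (i : Fin n) : TRel x z a n (fg F i + fgInv F i) (z • (fe F i + ff F i))

/-- The tied BMW algebra on `n + 1` strands with parameters `x, z, a`. -/
abbrev TBMW {F : Type*} [Field F] (x z a : F) (n : ℕ) : Type _ := RingQuot (TRel x z a n)

namespace TBMW

variable {F : Type*} [Field F] (x z a : F) {n : ℕ}

/-- The class of a free generator in the tied BMW algebra. -/
def gen (t : TGen n) : TBMW x z a n := RingQuot.mkAlgHom F (TRel x z a n) (FreeAlgebra.ι F t)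

def g (i : Fin n) : TBMW x z a n := gen x z a (TGen.g i)
def e (i : Fin n) : TBMW x z a n := gen x z a (TGen.e i)
def h (i : Fin n) : TBMW x z a n := gen x z a (TGen.h i)
def f (i : Fin n) : TBMW x z a n := gen x z a (TGen.f i)

theorem rel_castSucc {r s : FreeAlgebra F (TGen n)} (hrs : TRel x z a n r s) :
    TRel x z a (n + 1)
      (FreeAlgebra.lift F (fun t : TGen n => FreeAlgebra.ι F t.castSucc) r)
      (FreeAlgebra.lift F (fun t : TGen n => FreeAlgebra.ι F t.castSucc) s) := by
  cases hrs <;>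
    simp only [map_mul, map_add, map_smul, map_one, FreeAlgebra.lift_ι_apply, TGen.castSucc] <;>
    constructor <;> assumption

variable (n) in
/-- The natural map of the tower: the algebra on `n + 1` strands is sent to the algebra on `n + 2`
strands by adding a vertical strand on the right. -/
def incl : TBMW x z a n →ₐ[F] TBMW x z a (n + 1) :=
  RingQuot.liftAlgHom F
    ⟨(RingQuot.mkAlgHom F (TRel x z a (n + 1))).comp
        (FreeAlgebra.lift F (fun t : TGen n => FreeAlgebra.ι F t.castSucc)),
      fun {_ _} hrs => RingQuot.mkAlgHom_rel F (rel_castSucc x z a hrs)⟩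

end TBMW

/-- The Markov trace on the tower of tied BMW algebras, with `y = (a + a⁻¹) z⁻¹ - 1`. The map
`ϖ n` is the trace on `n + 1` strands. -/
structure IsTBMWMarkovTrace {F : Type*} [Field F] (x z a : F)
    (ϖ : ∀ n : ℕ, TBMW x z a n →ₗ[F] F) : Prop where
  one : ∀ n, ϖ n 1 = 1
  mul_comm : ∀ n (α β : TBMW x z a n), ϖ n (α * β) = ϖ n (β * α)
  mul_g : ∀ n (α : TBMW x z a n),
    ϖ (n + 1) (TBMW.incl x z a n α * TBMW.g x z a (Fin.last n)) = x * a * ϖ n α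
  mul_g_e : ∀ n (α : TBMW x z a n),
    ϖ (n + 1) (TBMW.incl x z a n α * (TBMW.g x z a (Fin.last n) * TBMW.e x z a (Fin.last n))) =
      x * a * ϖ n α
  mul_h : ∀ n (α : TBMW x z a n),
    ϖ (n + 1) (TBMW.incl x z a n α * TBMW.h x z a (Fin.last n)) = x * ϖ n α
  mul_f : ∀ n (α : TBMW x z a n),
    ϖ (n + 1) (TBMW.incl x z a n α * TBMW.f x z a (Fin.last n)) = x * ϖ n α
  mul_e : ∀ n (α : TBMW x z a n),
    ϖ (n + 1) (TBMW.incl x z a n α * TBMW.e x z a (Fin.last n)) =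
      x * ((a + a⁻¹) * z⁻¹ - 1) * ϖ n α

/-! ### The BMW algebra (reduced presentation) -/

/-- Generators of the BMW algebra: braid generators, their inverses, and tangle generators. -/
inductive Gen (n : ℕ) : Type
  | G (i : Fin n)
  | GInv (i : Fin n)
  | H (i : Fin n)

namespace Gen

/-- The inclusion of generators obtained by adding a strand on the right. -/
def castSucc {n : ℕ} : Gen n → Gen (n + 1)
  | G i => G i.castSucc
  | GInv i => GInv i.castSucc
  | H i => H i.castSucc

end Gen

section Free

variable (F : Type*) [Field F] {n : ℕ}

/-- The free generators. -/
abbrev fG (i : Fin n) : FreeAlgebra F (Gen n) := FreeAlgebra.ι F (Gen.G i)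
abbrev fGInv (i : Fin n) : FreeAlgebra F (Gen n) := FreeAlgebra.ι F (Gen.GInv i)
abbrev fH (i : Fin n) : FreeAlgebra F (Gen n) := FreeAlgebra.ι F (Gen.H i)

end Free

/-- The defining relations of the BMW algebra with parameters `ℓ, m`. -/
inductive Rel {F : Type*} [Field F] (ℓ m : F) (n : ℕ) :
    FreeAlgebra F (Gen n) → FreeAlgebra F (Gen n) → Prop
  | G_GInv (i : Fin n) : Rel ℓ m n (fG F i * fGInv F i) 1
  | GInv_G (i : Fin n) : Rel ℓ m n (fGInv F i * fG F i) 1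
  | G_comm (i j : Fin n) (hij : Far i j) : Rel ℓ m n (fG F i * fG F j) (fG F j * fG F i)
  | G_braid (i j : Fin n) (hij : Near i j) :
      Rel ℓ m n (fG F i * fG F j * fG F i) (fG F j * fG F i * fG F j)
  | GH_self (i : Fin n) : Rel ℓ m n (fG F i * fH F i) (ℓ⁻¹ • fH F i)
  | HGH (i j : Fin n) (hij : Near i j) : Rel ℓ m n (fH F i * fG F j * fH F i) (ℓ • fH F i)
  | skein (i : Fin n) : Rel ℓ m n (fG F i + fGInv F i) (m • (1 + fH F i))

/-- The BMW algebra on `n + 1` strands with parameters `ℓ, m`. -/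
abbrev BMW {F : Type*} [Field F] (ℓ m : F) (n : ℕ) : Type _ := RingQuot (Rel ℓ m n)

namespace BMW

variable {F : Type*} [Field F] (ℓ m : F) {n : ℕ}

/-- The class of a free generator in the BMW algebra. -/
def gen (t : Gen n) : BMW ℓ m n := RingQuot.mkAlgHom F (Rel ℓ m n) (FreeAlgebra.ι F t)

def G (i : Fin n) : BMW ℓ m n := gen ℓ m (Gen.G i)
def H (i : Fin n) : BMW ℓ m n := gen ℓ m (Gen.H i)

theorem rel_castSucc {r s : FreeAlgebra F (Gen n)} (hrs : Rel ℓ m n r s) :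
    Rel ℓ m (n + 1)
      (FreeAlgebra.lift F (fun t : Gen n => FreeAlgebra.ι F t.castSucc) r)
      (FreeAlgebra.lift F (fun t : Gen n => FreeAlgebra.ι F t.castSucc) s) := by
  cases hrs <;>
    simp only [map_mul, map_add, map_smul, map_one, FreeAlgebra.lift_ι_apply, Gen.castSucc] <;>
    constructor <;> assumption

variable (n) in
/-- The natural map of the tower, adding a vertical strand on the right. -/
def incl : BMW ℓ m n →ₐ[F] BMW ℓ m (n + 1) :=
  RingQuot.liftAlgHom F
    ⟨(RingQuot.mkAlgHom F (Rel ℓ m (n + 1))).comp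
        (FreeAlgebra.lift F (fun t : Gen n => FreeAlgebra.ι F t.castSucc)),
      fun {_ _} hrs => RingQuot.mkAlgHom_rel F (rel_castSucc ℓ m hrs)⟩

end BMW

/-- The Markov trace on the tower of BMW algebras; `τ n` is the trace on `n + 1` strands. -/
structure IsBMWMarkovTrace {F : Type*} [Field F] (ℓ m : F)
    (τ : ∀ n : ℕ, BMW ℓ m n →ₗ[F] F) : Prop where
  one : ∀ n, τ n 1 = 1
  mul_comm : ∀ n (c d : BMW ℓ m n), τ n (c * d) = τ n (d * c)
  mul_G : ∀ n (c : BMW ℓ m n),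
    τ (n + 1) (BMW.incl ℓ m n c * BMW.G ℓ m (Fin.last n)) =
      m * ℓ / (ℓ + ℓ⁻¹ - m) * τ n c
  mul_H : ∀ n (c : BMW ℓ m n),
    τ (n + 1) (BMW.incl ℓ m n c * BMW.H ℓ m (Fin.last n)) =
      m / (ℓ + ℓ⁻¹ - m) * τ n c

/-- The field `ℂ(a, z)` of rational functions in two variables. -/
abbrev RatFun2 : Type := FractionRing (MvPolynomial (Fin 2) ℂ)

/-- The variable `a` of `ℂ(a, z)`. -/
def aVar : RatFun2 := algebraMap (MvPolynomial (Fin 2) ℂ) RatFun2 (MvPolynomial.X 0)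

/-- The variable `z` of `ℂ(a, z)`. -/
def zVar : RatFun2 := algebraMap (MvPolynomial (Fin 2) ℂ) RatFun2 (MvPolynomial.X 1)

/-- The specialized parameter `x = z / (a + a⁻¹ - z)`. -/
def xSpec : RatFun2 := zVar / (aVar + aVar⁻¹ - zVar)

/-- The tied BMW algebra on `n + 1` strands, specialized at `x = z / (a + a⁻¹ - z)`. -/
abbrev KSpec (n : ℕ) : Type := TBMW xSpec zVar aVar n

/-- The BMW algebra on `n + 1` strands with `ℓ = a` and `m = z`. -/
abbrev CSpec (n : ℕ) : Type := BMW aVar zVar n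

/-- `φ` maps the generators as prescribed: `gᵢ ↦ Gᵢ`, `eᵢ ↦ 1`, `hᵢ ↦ Hᵢ`, `fᵢ ↦ Hᵢ`. -/
def MapsGenerators {n : ℕ} (φ : KSpec n →ₐ[RatFun2] CSpec n) : Prop :=
  ∀ i : Fin n,
    φ (TBMW.g _ _ _ i) = BMW.G _ _ i ∧
    φ (TBMW.e _ _ _ i) = 1 ∧
    φ (TBMW.h _ _ _ i) = BMW.H _ _ i ∧
    φ (TBMW.f _ _ _ i) = BMW.H _ _ i

end TiedBMW

end

set_option linter.unusedSectionVars false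

/-! Existence of the homomorphism means that the BMW algebra satisfies the tied relations when the
ties are 1 and each f equals h. Its reduced presentation lists only a few relations, so the others
are derived. H is a combination of G, G⁻¹ and 1; this gives H² = (m⁻¹(ℓ + ℓ⁻¹) − 1)H, whose scalar
is x⁻¹ exactly at the specialized x. The relation H_jG_iG_j = H_jH_i follows by computing one
product in two ways and cancelling ℓ⁻¹ − m (`BMWAdjacent.hgg`); `BMWAdjacent.adjacent` collects the
rest. Surjectivity is visible on generators, and uniqueness holds because g, e and h alone generate
the tied algebra.

The traces need more. At the specialization xy = 1, so the Markov rule for e demands that the BMW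
trace be unchanged when a strand is added, which is not among its axioms. Likewise the axioms of a
tied Markov trace say nothing directly about an element that avoids the last index. Both gaps are
closed by conjugation with the braid g_1⋯g_n (`TBMW.sweep`), which raises every index by one and
does not change a trace.

The induction rests on a normal form, `Tied.intervalAlg_le_bimoduleSpan`: the algebra generated by
an interval of indices is spanned by products r y s, where y is a one-index word in the top index
and r, s lie in the algebra of the lower indices. By cyclicity only products ρ y matter. If y ≠ 1, a
Markov rule removes a strand; if y = 1, the shift moves ρ to an interval that reaches the top index
but has one index less than the original one. Induction on the length of the interval gives
uniqueness of the tied Markov trace (`IsTBMWMarkovTrace.eq_on_interval`) and invariance of the BMW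
trace under adding a strand (`trace_incl_of_mem_interval`, applied to its pullback). The normal form
reduces to a computation with two neighbouring indices, `Strand.mul_mul_mem`. -/

namespace TiedBMW

/-! ### Identities between letters with one index or two neighbouring indices. -/

/-- If `g` intertwines `u` and `v`, then its inverse intertwines them the other way round. -/
theorem inv_mul_eq_mul_inv_of_mul_eq_mul {B : Type*} [Monoid B] {g gi u v : B} (h1 : gi * g = 1)
    (h2 : g * gi = 1) (h : u * g = g * v) : gi * u = v * gi := by
  calc gi * u = gi * (u * g) * gi := by simp only [mul_assoc, h2, mul_one]
    _ = v * gi := by rw [h, ← mul_assoc, h1, one_mul]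

/-- A braid generator, its inverse, a tie, a tangle and a tied tangle in an algebra. -/
structure Strand (B : Type*) where
  g : B
  gi : B
  e : B
  h : B
  f : B

namespace Strand

variable {F B : Type*} [Field F] [Ring B] [Algebra F B] {c z a : F} {s t : Strand B}

/-- The relations between the generators with one index. -/
structure Single (c z a : F) (s : Strand B) : Prop where
  g_gi : s.g * s.gi = 1
  gi_g : s.gi * s.g = 1
  hh : s.h * s.h = c • s.h
  gh : s.g * s.h = a⁻¹ • s.h
  hg : s.h * s.g = a⁻¹ • s.h
  ee : s.e * s.e = s.e
  eg : s.e * s.g = s.g * s.e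
  eh : s.e * s.h = s.h
  he : s.h * s.e = s.h
  fe : s.f * s.e = s.f
  ef : s.e * s.f = s.f
  fg : s.f * s.g = a⁻¹ • s.f
  gf : s.g * s.f = a⁻¹ • s.f
  skein : s.g + s.gi = z • (s.e + s.f)

/-- The relations between the generators with two neighbouring indices. -/
structure Adjacent (a : F) (s t : Strand B) : Prop where
  braid : s.g * t.g * s.g = t.g * s.g * t.g
  hgh : s.h * t.g * s.h = a • s.h
  hhh : s.h * t.h * s.h = s.h
  ggh : s.g * t.g * s.h = t.h * s.g * t.g
  hgg : t.h * s.g * t.g = t.h * s.h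
  ghg : s.g * t.h * s.g = t.gi * s.h * t.gi
  ghh : s.g * t.h * s.h = t.gi * s.h
  hhg : s.h * t.h * s.g = s.h * t.gi
  e_comm : s.e * t.e = t.e * s.e
  eeg : s.e * t.e * s.g = s.g * s.e * t.e
  gee : s.g * s.e * t.e = t.e * s.g * t.e
  egg : s.e * t.g * s.g = t.g * s.g * t.e
  fe : s.f * t.e = t.e * s.f
  ef : t.e * s.f = t.e * s.h * t.e
  gfg : s.g * t.f * s.g = t.gi * s.f * t.gi

/-! ### Consequences of the relations with one index -/

namespace Single

variable (hs : Single c z a s)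
include hs

theorem h_gi (ha : a ≠ 0) : s.h * s.gi = a • s.h := by
  have h1 : s.h * s.g * s.gi = s.h := by rw [mul_assoc, hs.g_gi, mul_one]
  rw [hs.hg, smul_mul_assoc] at h1
  rw [← h1, smul_smul, mul_inv_cancel₀ ha, one_smul, h1]

theorem gi_eq : s.gi = z • s.e + z • s.f - s.g := by
  rw [← smul_add, ← hs.skein]; abel

/-- The tied tangle is redundant as a generator; facts about it follow by linearity from those about
the braid generator, its inverse and the tie. -/
theorem f_eq (hz : z ≠ 0) : s.f = z⁻¹ • (s.g + s.gi) - s.e := by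
  rw [hs.skein, smul_smul, inv_mul_cancel₀ hz, one_smul]; abel

theorem gg : s.g * s.g = z • (s.g * s.e) + (z * a⁻¹) • s.f - 1 := by
  have h := congrArg (s.g * ·) hs.skein
  simp only [mul_add, mul_smul_comm, hs.g_gi, hs.gf] at h
  linear_combination (norm := module) h

/-- The inverse braid generator is a polynomial in the braid generator and the tie. -/
theorem gi_eq_poly (ha : a ≠ 0) :
    s.gi = a • (s.g * s.g) - s.g + a • 1 - (a * z) • (s.g * s.e) + z • s.e := by
  -- The polynomial comes from eliminating f between the skein relation and the quadratic relation
  -- `gg`.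
  rw [hs.gg, hs.gi_eq]
  match_scalars <;> field_simp <;> ring

/-- To the right of h, the letters g, gi and e act by a⁻¹, a and 1, so f acts by the parameter y. -/
theorem hf (hz : z ≠ 0) (ha : a ≠ 0) : s.h * s.f = (z⁻¹ * (a⁻¹ + a) - 1) • s.h := by
  rw [hs.f_eq hz, mul_sub, mul_smul_comm, mul_add, hs.hg, hs.h_gi ha, hs.he]
  module

end Single

/-! ### Consequences of the relations with two neighbouring indices -/

section Adjacent

variable (hs : Single c z a s) (ht : Single c z a t) (hst : Adjacent a s t) (hts : Adjacent a t s)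
include hs ht hst hts

theorem ege : s.e * t.g * s.e = s.e * t.e * t.g := by
  linear_combination (norm := noncomm_ring) -hts.gee - hts.eeg - hst.e_comm * t.g

theorem e_eg' : s.e * t.e * t.g = t.g * (s.e * t.e) := by
  linear_combination (norm := noncomm_ring) hst.e_comm * t.g + hts.eeg - t.g * hst.e_comm

theorem e_egi : s.e * t.e * t.gi = t.gi * (s.e * t.e) :=
  (inv_mul_eq_mul_inv_of_mul_eq_mul ht.gi_g ht.g_gi (e_eg' hs ht hst hts)).symm

theorem ege_right : s.e * t.g * s.e = t.g * (s.e * t.e) := by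
  rw [ege hs ht hst hts, e_eg' hs ht hst hts]

theorem e_f'_comm : s.e * t.f = t.f * s.e := hts.fe.symm

theorem ehe : s.e * t.h * s.e = s.e * t.f := hts.ef.symm

theorem ef'e : s.e * t.f * s.e = s.e * t.f := by
  linear_combination (norm := noncomm_ring) s.e * hts.fe + hs.ee * t.f

theorem egie : s.e * t.gi * s.e = s.e * t.e * t.gi := by
  have h1 := ege hs ht hst hts
  have h2 := ef'e hs ht hst hts
  have h3 : s.e * t.e * s.e = s.e * t.e := by
    linear_combination (norm := noncomm_ring) -s.e * hst.e_comm + hs.ee * t.e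
  have h4 : s.e * t.e * t.e = s.e * t.e := by rw [mul_assoc, ht.ee]
  have h5 : s.e * t.e * t.f = s.e * t.f := by rw [mul_assoc, ht.ef]
  rw [ht.gi_eq]
  simp only [mul_add, mul_sub, add_mul, sub_mul, mul_smul_comm, smul_mul_assoc, h1, h2, h3, h4, h5]

theorem hh'e : s.h * t.h * s.e = s.h * t.f := by
  linear_combination (norm := noncomm_ring)
    -hs.he * t.h * s.e + s.h * ehe hs ht hst hts + hs.he * t.f

theorem f'h : t.f * s.h = s.e * t.h * s.h := by
  linear_combination (norm := noncomm_ring)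
    -t.f * hs.eh + hts.fe * s.h - ehe hs ht hst hts * s.h + s.e * t.h * hs.eh

/-- A tie next to the tangle of the first strand absorbs its braid generator. -/
theorem he'g : s.h * t.e * s.g = a⁻¹ • (s.h * t.e) := by
  -- It suffices to compare after multiplying by the invertible `t.g`: then `egg` replaces `t.e *
  -- s.g * t.g` by `s.g * t.g * s.e`, and `s.g` is absorbed by `s.h`.
  have key : s.h * t.e * s.g * t.g = a⁻¹ • (s.h * t.e) * t.g := by
    have h1 : s.h * t.e * s.g * t.g = s.h * s.g * (t.g * s.e) := by
      linear_combination (norm := noncomm_ring) s.h * hts.egg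
    have h2 : s.h * (t.g * s.e) = s.h * t.e * t.g := by
      linear_combination (norm := noncomm_ring)
        -hs.he * t.g * s.e + s.h * ege hs ht hst hts + hs.he * t.e * t.g
    rw [h1, hs.hg, smul_mul_assoc, h2, smul_mul_assoc]
  simpa only [mul_assoc, ht.g_gi, mul_one, smul_mul_assoc] using congrArg (· * t.gi) key

theorem ge'h : s.g * t.e * s.h = a⁻¹ • (t.e * s.h) := by
  have key : t.g * (s.g * t.e * s.h) = t.g * (a⁻¹ • (t.e * s.h)) := by
    have h1 : t.g * (s.g * t.e * s.h) = s.e * t.g * (s.g * s.h) := by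
      linear_combination (norm := noncomm_ring) -hst.egg * s.h
    have h2 : s.e * t.g * s.h = t.g * (t.e * s.h) := by
      linear_combination (norm := noncomm_ring)
        -s.e * t.g * hs.eh + ege_right hs ht hst hts * s.h + t.g * hst.e_comm * s.h
          + t.g * t.e * hs.eh
    rw [h1, hs.gh, mul_smul_comm, h2, mul_smul_comm]
  simpa only [← mul_assoc, ht.gi_g, one_mul] using congrArg (t.gi * ·) key

theorem he'f (hz : z ≠ 0) (ha : a ≠ 0) :
    s.h * t.e * s.f = (z⁻¹ * (a⁻¹ + a) - 1) • (s.h * t.e) := by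
  rw [mul_assoc, ← hst.fe, ← mul_assoc, hs.hf hz ha, smul_mul_assoc]

/-- Multiplied on the right by `t.e`, the left side contains `t.e * s.h * t.e = t.e * s.f`, so
`he'f` applies. The extra tie is then removed by multiplying with `t.h * s.h`, since `t.h` absorbs
it and `s.h * t.h * s.h = s.h`. -/
theorem he'h (hz : z ≠ 0) (ha : a ≠ 0) :
    s.h * t.e * s.h = (z⁻¹ * (a⁻¹ + a) - 1) • s.h := by
  have h1 : s.h * t.e * s.h * t.e = (z⁻¹ * (a⁻¹ + a) - 1) • s.h * t.e := by
    rw [smul_mul_assoc, ← he'f hs ht hst hts hz ha, mul_assoc s.h t.e s.f, hst.ef]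
    simp only [mul_assoc]
  have h2 := congrArg (· * (t.h * s.h)) h1
  have h3 : s.h * t.e * s.h * t.e * (t.h * s.h) = s.h * t.e * s.h := by
    linear_combination (norm := noncomm_ring) s.h * t.e * s.h * ht.eh * s.h + s.h * t.e * hst.hhh
  have h4 : s.h * t.e * (t.h * s.h) = s.h := by
    linear_combination (norm := noncomm_ring) s.h * ht.eh * s.h + hst.hhh
  simpa only [smul_mul_assoc, h3, h4] using h2

theorem he'e : s.h * t.e * s.e = s.h * t.e := by
  linear_combination (norm := noncomm_ring) -s.h * hst.e_comm + hs.he * t.e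

theorem hg'e : s.h * t.g * s.e = s.h * (t.g * t.e) := by
  linear_combination (norm := noncomm_ring)
    -hs.he * t.g * s.e + s.h * ege hs ht hst hts + hs.he * t.e * t.g + s.h * ht.eg

theorem hf'e : s.h * t.f * s.e = s.h * t.f := by
  linear_combination (norm := noncomm_ring) s.h * hts.fe + hs.he * t.f

theorem hg'e'e : s.h * (t.g * t.e) * s.e = s.h * (t.g * t.e) := by
  linear_combination (norm := noncomm_ring)
    -hg'e hs ht hst hts * s.e + s.h * t.g * hs.ee + hg'e hs ht hst hts

/-- The product `s.h * t.f` is `s.h * t.h * s.e`; the tie passes `s.g`, after which `hhg` produces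
`s.h * t.gi`, and the skein relation expands the inverse. -/
theorem hf'g : s.h * t.f * s.g = z • (s.h * t.e) + z • (s.h * t.f) - s.h * (t.g * t.e) := by
  have h1 : s.h * t.f * s.g = s.h * t.h * s.g * s.e := by
    rw [← hh'e hs ht hst hts, mul_assoc _ s.e s.g, hs.eg, mul_assoc _ s.g s.e]
  rw [h1, hst.hhg, ht.gi_eq]
  simp only [mul_add, mul_sub, add_mul, sub_mul, mul_smul_comm, smul_mul_assoc,
    he'e hs ht hst hts, hg'e hs ht hst hts, hf'e hs ht hst hts]

/-- A product in which a tie commutes past a braid. -/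
theorem eg'e'g : s.e * (t.g * t.e) * s.g = t.g * (s.g * s.e) * t.e := by
  have key : s.e * (t.g * t.e) * s.g * t.g = t.g * (s.g * s.e) * t.e * t.g := by
    linear_combination (norm := noncomm_ring) s.e * t.g * hts.egg + hst.egg * t.g * s.e
      + t.g * s.g * ht.eg * s.e - t.g * s.g * hts.eeg - t.g * s.g * hst.e_comm * t.g
  simpa only [mul_assoc, ht.g_gi, mul_one] using congrArg (· * t.gi) key

theorem hg'e'g : s.h * (t.g * t.e) * s.g = s.h * t.f := by
  have h1 : s.h * (t.g * t.e) * s.g = s.h * (s.e * (t.g * t.e) * s.g) := by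
    linear_combination (norm := noncomm_ring) -hs.he * t.g * t.e * s.g
  rw [h1, eg'e'g hs ht hst hts]
  have h2 : s.h * (t.g * (s.g * s.e) * t.e) = s.h * t.g * s.g * s.e * t.e := by
    simp only [mul_assoc]
  rw [h2, hts.hgg, hh'e hs ht hst hts, mul_assoc, ht.fe]

theorem hf'h : s.h * t.f * s.h = s.h := by
  rw [← hh'e hs ht hst hts, mul_assoc, hs.eh, hst.hhh]

theorem hg'e'h : s.h * (t.g * t.e) * s.h = a • s.h := by
  rw [← hg'e hs ht hst hts, mul_assoc, hs.eh, hst.hgh]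

end Adjacent

end Strand

end TiedBMW

/-! ### Stabilizers of subspaces and bimodules over a subalgebra. -/

namespace TiedBMW

section Stabilizer

variable {F B : Type*} [Field F] [Ring B] [Algebra F B]

/-- The elements whose left multiplication preserves a subspace. -/
def leftStabilizer (M : Submodule F B) : Subalgebra F B where
  carrier := {x | ∀ m ∈ M, x * m ∈ M}
  mul_mem' hx hy m hm := by rw [mul_assoc]; exact hx _ (hy _ hm)
  add_mem' hx hy m hm := by rw [add_mul]; exact add_mem (hx _ hm) (hy _ hm)
  algebraMap_mem' r m hm := by rw [← Algebra.smul_def]; exact M.smul_mem r hm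

/-- The elements whose right multiplication preserves a subspace. -/
def rightStabilizer (M : Submodule F B) : Subalgebra F B where
  carrier := {x | ∀ m ∈ M, m * x ∈ M}
  mul_mem' hx hy m hm := by rw [← mul_assoc]; exact hy _ (hx _ hm)
  add_mem' hx hy m hm := by rw [mul_add]; exact add_mem (hx _ hm) (hy _ hm)
  algebraMap_mem' r m hm := by
    rw [← Algebra.commutes, ← Algebra.smul_def]; exact M.smul_mem r hm

theorem mul_mul_mem_of_mem_span {S T : Set B} {x : B} {M : Submodule F B}
    (H : ∀ u ∈ S, ∀ v ∈ T, x * u * v ∈ M) {u v : B} (hu : u ∈ Submodule.span F S)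
    (hv : v ∈ Submodule.span F T) : x * u * v ∈ M := by
  induction hu using Submodule.span_induction with
  | zero => simp
  | add _ _ _ _ h1 h2 => rw [mul_add, add_mul]; exact add_mem h1 h2
  | smul r _ _ h1 => rw [mul_smul_comm, smul_mul_assoc]; exact M.smul_mem r h1
  | mem u hu =>
    induction hv using Submodule.span_induction with
    | zero => simp
    | add _ _ _ _ h1 h2 => rw [mul_add]; exact add_mem h1 h2
    | smul r _ _ h1 => rw [mul_smul_comm]; exact M.smul_mem r h1
    | mem v hv => exact H u hu v hv

/-- The bimodule over a subalgebra that is generated by a subspace. -/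
def bimoduleSpan (R : Subalgebra F B) (Q : Submodule F B) : Submodule F B :=
  Subalgebra.toSubmodule R * Q * Subalgebra.toSubmodule R

theorem mul_mul_mem_bimoduleSpan {R : Subalgebra F B} {Q : Submodule F B} {r y s : B} (hr : r ∈ R)
    (hy : y ∈ Q) (hs : s ∈ R) : r * y * s ∈ bimoduleSpan R Q :=
  Submodule.mul_mem_mul (Submodule.mul_mem_mul hr hy) hs

theorem bimoduleSpan_induction {R : Subalgebra F B} {Q : Submodule F B} {P : B → Prop}
    (hadd : ∀ u v, P u → P v → P (u + v))
    (hmul : ∀ r ∈ R, ∀ y ∈ Q, ∀ s ∈ R, P (r * y * s)) {u : B} (hu : u ∈ bimoduleSpan R Q) :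
    P u := by
  refine Submodule.mul_induction_on hu (fun m hm s hs => ?_) hadd
  refine Submodule.mul_induction_on hm (fun r hr y hy => hmul r hr y hy s hs) fun u v h1 h2 => ?_
  rw [add_mul]
  exact hadd _ _ h1 h2

theorem mul_mul_mem_bimoduleSpan_of_mem {R : Subalgebra F B} {Q : Submodule F B} {r m s : B}
    (hr : r ∈ R) (hm : m ∈ bimoduleSpan R Q) (hs : s ∈ R) : r * m * s ∈ bimoduleSpan R Q := by
  refine bimoduleSpan_induction (P := fun m => r * m * s ∈ bimoduleSpan R Q)
    (fun u v h1 h2 => ?_) (fun r' hr' y hy s' hs' => ?_) hm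
  · rw [mul_add, add_mul]; exact add_mem h1 h2
  · have : r * (r' * y * s') * s = r * r' * y * (s' * s) := by simp only [mul_assoc]
    rw [this]
    exact mul_mul_mem_bimoduleSpan (mul_mem hr hr') hy (mul_mem hs' hs)

end Stabilizer

/-! ### One-index words, and two-index words that begin with a tangle or a tie. -/

namespace Strand

variable {F B : Type*} [Field F] [Ring B] [Algebra F B] {c z a : F} {s t : Strand B}

variable (F) in
/-- The span of the words in the generators with one index. -/
def localSpan (s : Strand B) : Submodule F B :=
  Submodule.span F {1, s.g, s.e, s.h, s.f, s.g * s.e}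

theorem one_mem : 1 ∈ localSpan F s := Submodule.subset_span (by simp)
theorem g_mem : s.g ∈ localSpan F s := Submodule.subset_span (by simp)
theorem e_mem : s.e ∈ localSpan F s := Submodule.subset_span (by simp)
theorem h_mem : s.h ∈ localSpan F s := Submodule.subset_span (by simp)
theorem f_mem : s.f ∈ localSpan F s := Submodule.subset_span (by simp)
theorem ge_mem : s.g * s.e ∈ localSpan F s := Submodule.subset_span (by simp)

theorem Single.gi_mem (hs : Single c z a s) : s.gi ∈ localSpan F s := by
  rw [hs.gi_eq]
  exact sub_mem (add_mem (Submodule.smul_mem _ _ e_mem) (Submodule.smul_mem _ _ f_mem)) g_mem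

/-- A subalgebra containing the braid generator and the tie contains the inverse generator. -/
theorem Single.gi_mem_of_mem (hs : Single c z a s) (ha : a ≠ 0) {A : Subalgebra F B}
    (hg : s.g ∈ A) (he : s.e ∈ A) : s.gi ∈ A := by
  rw [hs.gi_eq_poly ha]
  exact add_mem (sub_mem (add_mem (sub_mem (A.smul_mem (mul_mem hg hg) _) hg)
    (A.smul_mem A.one_mem _)) (A.smul_mem (mul_mem hg he) _)) (A.smul_mem he _)

theorem Single.f_mem_of_mem (hs : Single c z a s) (hz : z ≠ 0) (ha : a ≠ 0) {A : Subalgebra F B}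
    (hg : s.g ∈ A) (he : s.e ∈ A) : s.f ∈ A := by
  rw [hs.f_eq hz]
  exact sub_mem (A.smul_mem (add_mem hg (hs.gi_mem_of_mem ha hg he)) _) he

theorem Single.localSpan_le (hs : Single c z a s) (hz : z ≠ 0) (ha : a ≠ 0) {A : Subalgebra F B}
    (hg : s.g ∈ A) (he : s.e ∈ A) (hh : s.h ∈ A) : localSpan F s ≤ Subalgebra.toSubmodule A := by
  refine Submodule.span_le.2 ?_
  rintro _ (rfl | rfl | rfl | rfl | rfl | rfl)
  exacts [A.one_mem, hg, he, hh, hs.f_mem_of_mem hz ha hg he, A.mul_mem hg he]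

/-- The span of the words with one index is closed under multiplication by the generators. -/
theorem Single.mul_mem_localSpan (hs : Single c z a s) (hz : z ≠ 0) (ha : a ≠ 0) {x y : B}
    (hx : x ∈ ({s.g, s.e, s.h} : Set B)) (hy : y ∈ localSpan F s) : x * y ∈ localSpan F s := by
  have h1 : x * 1 * y ∈ localSpan F s := by
    refine mul_mul_mem_of_mem_span (S := {1}) ?_ (Submodule.subset_span rfl) hy
    rintro u rfl v hv
    rw [mul_one]
    rcases hx with rfl | rfl | rfl
    · rcases hv with rfl | rfl | rfl | rfl | rfl | rfl
      · rw [mul_one]; exact g_mem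
      · rw [hs.gg]
        exact sub_mem (add_mem (Submodule.smul_mem _ _ ge_mem) (Submodule.smul_mem _ _ f_mem))
          one_mem
      · exact ge_mem
      · rw [hs.gh]; exact Submodule.smul_mem _ _ h_mem
      · rw [hs.gf]; exact Submodule.smul_mem _ _ f_mem
      · rw [← mul_assoc, hs.gg, sub_mul, add_mul, smul_mul_assoc, smul_mul_assoc, mul_assoc,
          hs.ee, hs.fe, one_mul]
        exact sub_mem (add_mem (Submodule.smul_mem _ _ ge_mem) (Submodule.smul_mem _ _ f_mem))
          e_mem
    · rcases hv with rfl | rfl | rfl | rfl | rfl | rfl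
      · rw [mul_one]; exact e_mem
      · rw [hs.eg]; exact ge_mem
      · rw [hs.ee]; exact e_mem
      · rw [hs.eh]; exact h_mem
      · rw [hs.ef]; exact f_mem
      · rw [← mul_assoc, hs.eg, mul_assoc, hs.ee]; exact ge_mem
    · rcases hv with rfl | rfl | rfl | rfl | rfl | rfl
      · rw [mul_one]; exact h_mem
      · rw [hs.hg]; exact Submodule.smul_mem _ _ h_mem
      · rw [hs.he]; exact h_mem
      · rw [hs.hh]; exact Submodule.smul_mem _ _ h_mem
      · rw [hs.hf hz ha]; exact Submodule.smul_mem _ _ h_mem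
      · rw [← mul_assoc, hs.hg, smul_mul_assoc, hs.he]; exact Submodule.smul_mem _ _ h_mem
  rwa [mul_one] at h1

section Adjacent

variable (hs : Single c z a s) (ht : Single c z a t) (hst : Adjacent a s t) (hts : Adjacent a t s)
  (hz : z ≠ 0) (ha : a ≠ 0)
include hs ht hst hts hz ha

/-- The space `s.h * localSpan F t` is stable under right multiplication by the letters of `s`. The
right stabilizer is a subalgebra, so g, e and h need checking, while f comes for free as a
polynomial in g and e. -/
theorem h_mul_mul {r y : B} (hr : r ∈ localSpan F t) (hy : y ∈ localSpan F s) :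
    ∃ r' ∈ localSpan F t, s.h * r * y = s.h * r' := by
  have key : localSpan F s ≤ Subalgebra.toSubmodule
      (rightStabilizer ((localSpan F t).map (LinearMap.mulLeft F s.h))) := by
    refine hs.localSpan_le hz ha ?_ ?_ ?_ <;> rintro _ ⟨r, hr, rfl⟩ <;>
      rw [LinearMap.mulLeft_apply]
    · refine mul_mul_mem_of_mem_span (T := {s.g}) ?_ hr (Submodule.subset_span rfl)
      rintro u hu _ rfl
      rcases hu with rfl | rfl | rfl | rfl | rfl | rfl
      · exact ⟨a⁻¹ • 1, Submodule.smul_mem _ _ one_mem, by simp [hs.hg]⟩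
      · exact ⟨_, h_mem, hts.hgg.symm⟩
      · exact ⟨a⁻¹ • t.e, Submodule.smul_mem _ _ e_mem, by simp [he'g hs ht hst hts]⟩
      · exact ⟨_, ht.gi_mem, hst.hhg.symm⟩
      · exact ⟨z • t.e + z • t.f - t.g * t.e, sub_mem (add_mem (Submodule.smul_mem _ _ e_mem)
          (Submodule.smul_mem _ _ f_mem)) ge_mem, by
            simp [hf'g hs ht hst hts, mul_add, mul_sub]⟩
      · exact ⟨_, f_mem, (hg'e'g hs ht hst hts).symm⟩
    · refine mul_mul_mem_of_mem_span (T := {s.e}) ?_ hr (Submodule.subset_span rfl)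
      rintro u hu _ rfl
      rcases hu with rfl | rfl | rfl | rfl | rfl | rfl
      · exact ⟨1, one_mem, by simp [hs.he]⟩
      · exact ⟨_, ge_mem, (hg'e hs ht hst hts).symm⟩
      · exact ⟨_, e_mem, (he'e hs ht hst hts).symm⟩
      · exact ⟨_, f_mem, (hh'e hs ht hst hts).symm⟩
      · exact ⟨_, f_mem, (hf'e hs ht hst hts).symm⟩
      · exact ⟨_, ge_mem, (hg'e'e hs ht hst hts).symm⟩
    · refine mul_mul_mem_of_mem_span (T := {s.h}) ?_ hr (Submodule.subset_span rfl)
      rintro u hu _ rfl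
      have hsmul : ∀ k : F, k • s.h ∈ (localSpan F t).map (LinearMap.mulLeft F s.h) := fun k =>
        ⟨k • 1, Submodule.smul_mem _ _ one_mem, by simp⟩
      have h1 := hsmul 1
      rw [one_smul] at h1
      rcases hu with rfl | rfl | rfl | rfl | rfl | rfl
      · rw [mul_one, hs.hh]; exact hsmul _
      · rw [hst.hgh]; exact hsmul _
      · rw [he'h hs ht hst hts hz ha]; exact hsmul _
      · rw [hst.hhh]; exact h1
      · rw [hf'h hs ht hst hts]; exact h1
      · rw [hg'e'h hs ht hst hts]; exact hsmul _
  obtain ⟨r', hr', h⟩ := key hy (s.h * r) ⟨r, hr, rfl⟩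
  exact ⟨r', hr', h.symm⟩

variable {R : Subalgebra F B} (hR : localSpan F t ≤ Subalgebra.toSubmodule R)
include hR

/-- The left factor p is needed because rewriting `s.g * t.h` as a word containing `s.h` leaves
`t.gi` in front. -/
theorem mul_h_mul_mul_mem {p r y : B} (hp : p ∈ R) (hr : r ∈ localSpan F t)
    (hy : y ∈ localSpan F s) : p * (s.h * r * y) ∈ bimoduleSpan R (localSpan F s) := by
  obtain ⟨r', hr', h⟩ := h_mul_mul hs ht hst hts hz ha hr hy
  rw [h, ← mul_assoc]
  exact mul_mul_mem_bimoduleSpan hp h_mem (hR hr')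

/-- For each basis word u of `t` there is p in R with `s.e * u * s.e = p * s.e`. The words e, h, f
and ge absorb a tie on the left, so for them the first tie can be traded for p; besides the trivial
word, only the final letter g needs its own computation. -/
theorem e_mul_mul_mem {r y : B} (hr : r ∈ localSpan F t) (hy : y ∈ localSpan F s) :
    s.e * r * y ∈ bimoduleSpan R (localSpan F s) := by
  have mem : ∀ {p y q : B}, p ∈ R → y ∈ localSpan F s → q ∈ R →
    p * y * q ∈ bimoduleSpan R (localSpan F s) := mul_mul_mem_bimoduleSpan
  have h1 : (1 : B) ∈ R := R.one_mem
  have hg : t.g ∈ R := hR g_mem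
  have he : t.e ∈ R := hR e_mem
  have hf : t.f ∈ R := hR f_mem
  have hgi : t.gi ∈ R := hR ht.gi_mem
  have key : ∀ u ∈ R, ∀ p ∈ R, s.e * u * s.e = p * s.e →
      s.e * u * s.g ∈ bimoduleSpan R (localSpan F s) →
      ∀ v ∈ ({1, s.g, s.e, s.h, s.f, s.g * s.e} : Set B),
        s.e * u * v ∈ bimoduleSpan R (localSpan F s) := by
    intro u hu p hp hup hug v hv
    have hv' : ∀ w, s.e * w ∈ localSpan F s →
        s.e * u * (s.e * w) ∈ bimoduleSpan R (localSpan F s) := by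
      intro w hw
      have : s.e * u * (s.e * w) = p * (s.e * w) * 1 := by
        rw [← mul_assoc, hup, mul_one, mul_assoc]
      rw [this]
      exact mem hp hw h1
    rcases hv with rfl | rfl | rfl | rfl | rfl | rfl
    · rw [mul_one, ← one_mul s.e]; exact mem h1 e_mem hu
    · exact hug
    · have h := hv' 1 (by rw [mul_one]; exact e_mem)
      rwa [mul_one] at h
    · have h := hv' s.h (by rw [hs.eh]; exact h_mem)
      rwa [hs.eh] at h
    · have h := hv' s.f (by rw [hs.ef]; exact f_mem)
      rwa [hs.ef] at h
    · have h := hv' s.g (by rw [hs.eg]; exact ge_mem)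
      rwa [hs.eg] at h
  refine mul_mul_mem_of_mem_span ?_ hr hy
  rintro u (rfl | rfl | rfl | rfl | rfl | rfl)
  · refine key _ h1 1 h1 (by rw [mul_one, one_mul, hs.ee]) ?_
    rw [mul_one, hs.eg, ← one_mul (s.g * s.e), ← mul_one (1 * _)]
    exact mem h1 ge_mem h1
  · refine key _ hg (t.g * t.e) (mul_mem hg he) ?_ ?_
    · rw [ege_right hs ht hst hts, hst.e_comm, mul_assoc]
    · rw [hst.egg]; exact mem hg g_mem he
  · refine key _ he t.e he ?_ ?_
    · rw [hst.e_comm, mul_assoc, hs.ee]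
    · have : s.e * t.e * s.g = t.e * (s.g * s.e) * 1 := by
        rw [hst.e_comm, mul_assoc, hs.eg, mul_one]
      rw [this]
      exact mem he ge_mem h1
  · refine key _ (hR h_mem) t.f hf ?_ ?_
    · rw [ehe hs ht hst hts, e_f'_comm hs ht hst hts]
    · have h2 : t.h * s.g = t.h * s.h * t.gi := by
        rw [← hst.hgg, mul_assoc, mul_assoc, ht.g_gi, mul_one]
      have : s.e * t.h * s.g = t.f * s.h * t.gi := by
        rw [f'h hs ht hst hts, mul_assoc, h2]; simp only [mul_assoc]
      rw [this]
      exact mem hf h_mem hgi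
  · refine key _ hf t.f hf ?_ ?_
    · rw [ef'e hs ht hst hts, e_f'_comm hs ht hst hts]
    · have : s.e * t.f * s.g = t.f * (s.g * s.e) * 1 := by
        rw [e_f'_comm hs ht hst hts, mul_assoc, hs.eg, mul_one]
      rw [this]
      exact mem hf ge_mem h1
  · refine key _ (mul_mem hg he) (t.g * t.e) (mul_mem hg he) ?_ ?_
    · linear_combination (norm := noncomm_ring) -s.e * t.g * hst.e_comm
        + ege_right hs ht hst hts * t.e + t.g * s.e * ht.ee + t.g * hst.e_comm
    · rw [eg'e'g hs ht hst hts]; exact mem hg ge_mem he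

end Adjacent

end Strand

end TiedBMW

/-! ### Two-index words that begin with a braid generator, and the normal form. -/

namespace TiedBMW

namespace Strand

variable {F B : Type*} [Field F] [Ring B] [Algebra F B] {c z a : F} {s t : Strand B}

section Adjacent

variable (hs : Single c z a s) (ht : Single c z a t) (hst : Adjacent a s t) (hts : Adjacent a t s)
include hs ht hst hts

theorem gg'gi : s.g * t.g * s.gi = t.gi * s.g * t.g := by
  linear_combination (norm := noncomm_ring) -ht.gi_g * s.g * t.g * s.gi - t.gi * hst.braid * s.gi
    + t.gi * s.g * t.g * hs.g_gi

/-- Moving from right to left across `s.g * t.g` turns g, gi and e of `s` into those of `t`, hence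
also f, which is a combination of them. -/
theorem gg'f (hz : z ≠ 0) : s.g * t.g * s.f = t.f * s.g * t.g := by
  rw [hs.f_eq hz, ht.f_eq hz, mul_sub, sub_mul, sub_mul, mul_smul_comm, smul_mul_assoc,
    smul_mul_assoc, mul_add, add_mul, add_mul, hst.braid, gg'gi hs ht hst hts, ← hts.egg]

theorem gie_ge : t.gi * s.e * t.g * s.e = s.e * t.e := by
  linear_combination (norm := noncomm_ring) t.gi * ege_right hs ht hst hts + ht.gi_g * s.e * t.e

theorem ge'_eq : s.g * t.e = t.gi * s.e * t.g * s.g := by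
  linear_combination (norm := noncomm_ring) -ht.gi_g * s.g * t.e - t.gi * hst.egg

/-- Writing `s.g * t.e` as `t.gi * s.e * t.g * s.g` creates the square of `s.g`, to which the
quadratic relation applies. -/
theorem ge'g : s.g * t.e * s.g =
    z • (t.e * (s.g * s.e)) + (z * a⁻¹) • (t.e * s.f) - t.gi * s.e * t.g := by
  have h1 : t.gi * s.e * t.g * (s.g * s.e) = t.e * (s.g * s.e) := by
    linear_combination (norm := noncomm_ring) -t.gi * s.e * t.g * hs.eg
      + gie_ge hs ht hst hts * s.g + hst.e_comm * s.g + t.e * hs.eg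
  have h2 : t.gi * s.e * t.g * s.f = t.e * s.f := by
    linear_combination (norm := noncomm_ring) -t.gi * s.e * t.g * hs.ef
      + gie_ge hs ht hst hts * s.f + hst.e_comm * s.f + t.e * hs.ef
  rw [ge'_eq hs ht hst hts, mul_assoc, hs.gg, mul_sub, mul_add, mul_smul_comm, mul_smul_comm, h1,
    h2, mul_one]

theorem ge'ge : s.g * t.e * (s.g * s.e) =
    z • (t.e * (s.g * s.e)) + (z * a⁻¹) • (t.e * s.f) - t.e * s.e := by
  have h1 : t.e * (s.g * s.e) * s.e = t.e * (s.g * s.e) := by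
    rw [mul_assoc, mul_assoc s.g, hs.ee]
  have h2 : t.e * s.f * s.e = t.e * s.f := by rw [mul_assoc, hs.fe]
  rw [← mul_assoc, ge'g hs ht hst hts, sub_mul, add_mul, smul_mul_assoc, smul_mul_assoc, h1, h2,
    gie_ge hs ht hst hts, hst.e_comm]

theorem ge'f : s.g * t.e * s.f = a⁻¹ • (s.f * t.e) := by
  rw [mul_assoc, ← hst.fe, ← mul_assoc, hs.gf, smul_mul_assoc]

/-- This trades an initial braid generator for an initial tangle, so that `h_mul_mul` takes over. -/
theorem gh'_eq : s.g * t.h = t.gi * (s.h * t.h) := by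
  linear_combination (norm := noncomm_ring) -ht.gi_g * s.g * t.h + t.gi * hts.ggh + t.gi * hts.hgg

theorem gf'gi (hz : z ≠ 0) : s.g * t.f * s.gi = t.gi * s.f * t.g := by
  linear_combination (norm := noncomm_ring) -ht.gi_g * s.g * t.f * s.gi
    + t.gi * gg'f ht hs hts hst hz * s.gi + t.gi * s.f * t.g * hs.g_gi

theorem gf'f (hz : z ≠ 0) : s.g * t.f * s.f =
    z⁻¹ • (t.gi * s.f * t.gi + t.gi * s.f * t.g) - s.g * s.e * t.f := by
  rw [hs.f_eq hz, mul_sub, mul_smul_comm, mul_add, ← hs.f_eq hz, hst.gfg, gf'gi hs ht hst hts hz,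
    mul_assoc s.g t.f s.e, hts.fe, mul_assoc s.g s.e]

theorem gf'h : s.g * t.f * s.h = t.gi * t.e * s.h := by
  linear_combination (norm := noncomm_ring) s.g * f'h hs ht hst hts - hs.eg * t.h * s.h
    + s.e * hst.ghh - s.e * t.gi * hs.eh + egie hs ht hst hts * s.h
    + e_egi hs ht hst hts * s.h + t.gi * hst.e_comm * s.h + t.gi * t.e * hs.eh

theorem gf'ge : s.g * t.f * (s.g * s.e) = t.gi * s.f * (t.e * t.gi) := by
  linear_combination (norm := noncomm_ring) hst.gfg * s.e - t.gi * hs.fe * t.gi * s.e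
    + t.gi * s.f * egie hs ht hst hts + t.gi * hs.fe * t.e * t.gi

/-- The tie need not commute with `t.g`, but it commutes with every term of the quadratic relation
for `t.g * t.g`. -/
theorem e_g'g' : s.e * (t.g * t.g) = t.g * t.g * s.e := by
  have h1 : s.e * (t.g * t.e) = t.g * t.e * s.e := by
    linear_combination (norm := noncomm_ring) -s.e * ht.eg + hst.e_comm * t.g + hts.eeg
  rw [ht.gg, mul_sub, sub_mul, mul_add, add_mul, mul_smul_comm, mul_smul_comm, smul_mul_assoc,
    smul_mul_assoc, h1, e_f'_comm hs ht hst hts, mul_one, one_mul]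

theorem gg'e'g : s.g * (t.g * t.e) * s.g = t.g * (s.g * s.e) * t.g := by
  -- After multiplication by the invertible `t.g`, the relation `egg` turns the tie of `t` into a
  -- tie of `s`, which then passes the square of `t.g`.
  have key : s.g * (t.g * t.e) * s.g * t.g = t.g * (s.g * s.e) * t.g * t.g := by
    linear_combination (norm := noncomm_ring) s.g * t.g * hts.egg + hst.braid * t.g * s.e
      - t.g * s.g * e_g'g' hs ht hst hts
  simpa only [mul_assoc, ht.g_gi, mul_one] using congrArg (· * t.gi) key

theorem gg'e'e : s.g * (t.g * t.e) * s.e = s.g * s.e * (t.e * t.g) := by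
  linear_combination (norm := noncomm_ring) -s.g * hts.eeg - s.g * hst.e_comm * t.g

theorem gg'e'ge : s.g * (t.g * t.e) * (s.g * s.e) = t.g * (s.g * s.e) * (t.e * t.g) := by
  linear_combination (norm := noncomm_ring) gg'e'g hs ht hst hts * s.e
    + t.g * s.g * ege hs ht hst hts

theorem gg'e'h : s.g * (t.g * t.e) * s.h = t.f * s.h := by
  linear_combination (norm := noncomm_ring) -s.g * t.g * t.e * hs.eh
    + gg'e'e hs ht hst hts * s.h - hst.eeg * t.g * s.h + s.e * t.e * hst.ggh
    + s.e * t.e * hst.hgg + s.e * ht.eh * s.h - f'h hs ht hst hts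

variable (hz : z ≠ 0) (ha : a ≠ 0)
variable {R : Subalgebra F B} (hR : localSpan F t ≤ Subalgebra.toSubmodule R)
include hR hz ha

/-- Each pair of basis words is brought to a form in which the letters of `s` occur in one block,
flanked by elements of R; the braid-type relations move that block. -/
theorem g_mul_mul_mem {r y : B} (hr : r ∈ localSpan F t) (hy : y ∈ localSpan F s) :
    s.g * r * y ∈ bimoduleSpan R (localSpan F s) := by
  have mem : ∀ {p y q : B}, p ∈ R → y ∈ localSpan F s → q ∈ R →
    p * y * q ∈ bimoduleSpan R (localSpan F s) := mul_mul_mem_bimoduleSpan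
  have h1 : (1 : B) ∈ R := R.one_mem
  have meml : ∀ {p y : B}, p ∈ R → y ∈ localSpan F s →
      p * y ∈ bimoduleSpan R (localSpan F s) := fun hp hy => by
    simpa only [mul_one] using mem hp hy h1
  have memr : ∀ {y q : B}, y ∈ localSpan F s → q ∈ R →
      y * q ∈ bimoduleSpan R (localSpan F s) := fun hy hq => by
    simpa only [one_mul] using mem h1 hy hq
  have smul : ∀ (k : F) {m : B}, m ∈ bimoduleSpan R (localSpan F s) →
    k • m ∈ bimoduleSpan R (localSpan F s) := fun k {m} hm => Submodule.smul_mem _ k hm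
  have hg : t.g ∈ R := hR g_mem
  have he : t.e ∈ R := hR e_mem
  have hh : t.h ∈ R := hR h_mem
  have hf : t.f ∈ R := hR f_mem
  have hgi : t.gi ∈ R := hR ht.gi_mem
  have hge : t.g * t.e ∈ R := mul_mem hg he
  refine mul_mul_mem_of_mem_span ?_ hr hy
  rintro u (rfl | rfl | rfl | rfl | rfl | rfl)
  · intro v hv
    rw [mul_one]
    have := memr (hs.mul_mem_localSpan hz ha (x := s.g) (by simp) (Submodule.subset_span hv)) h1
    rwa [mul_one] at this
  · rintro v (rfl | rfl | rfl | rfl | rfl | rfl)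
    · rw [mul_one]; exact memr g_mem hg
    · rw [hst.braid]; exact mem hg g_mem hg
    · rw [← hts.egg]; exact mem he g_mem hg
    · rw [hst.ggh]; exact mem hh g_mem hg
    · rw [gg'f hs ht hst hts hz]; exact mem hf g_mem hg
    · have : s.g * t.g * (s.g * s.e) = t.g * t.e * s.g * t.g := by
        linear_combination (norm := noncomm_ring) hst.braid * s.e - t.g * hts.egg
      rw [this]
      exact mem hge g_mem hg
  · rintro v (rfl | rfl | rfl | rfl | rfl | rfl)
    · rw [mul_one]; exact memr g_mem he
    · rw [ge'g hs ht hst hts]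
      exact sub_mem (add_mem (smul _ (meml he ge_mem)) (smul _ (meml he f_mem)))
        (mem hgi e_mem hg)
    · rw [mul_assoc, ← hst.e_comm, ← mul_assoc]; exact memr ge_mem he
    · rw [ge'h hs ht hst hts]; exact smul _ (meml he h_mem)
    · rw [ge'f hs ht hst hts]; exact smul _ (memr f_mem he)
    · rw [ge'ge hs ht hst hts]
      exact sub_mem (add_mem (smul _ (meml he ge_mem)) (smul _ (meml he f_mem)))
        (meml he e_mem)
  · intro v hv
    rw [gh'_eq hs ht hst hts, mul_assoc]
    exact mul_h_mul_mul_mem hs ht hst hts hz ha hR hgi h_mem (Submodule.subset_span hv)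
  · rintro v (rfl | rfl | rfl | rfl | rfl | rfl)
    · rw [mul_one]; exact memr g_mem hf
    · rw [hst.gfg]; exact mem hgi f_mem hgi
    · rw [mul_assoc, hts.fe, ← mul_assoc]; exact memr ge_mem hf
    · rw [gf'h hs ht hst hts]; exact meml (mul_mem hgi he) h_mem
    · rw [gf'f hs ht hst hts hz]
      exact sub_mem (smul _ (add_mem (mem hgi f_mem hgi) (mem hgi f_mem hg))) (memr ge_mem hf)
    · rw [gf'ge hs ht hst hts]; exact mem hgi f_mem (mul_mem he hgi)
  · rintro v (rfl | rfl | rfl | rfl | rfl | rfl)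
    · rw [mul_one]; exact memr g_mem hge
    · rw [gg'e'g hs ht hst hts]; exact mem hg ge_mem hg
    · rw [gg'e'e hs ht hst hts]; exact memr ge_mem (mul_mem he hg)
    · rw [gg'e'h hs ht hst hts]; exact meml hf h_mem
    · have : s.g * (t.g * t.e) * s.f = t.f * s.g * (t.g * t.e) := by
        linear_combination (norm := noncomm_ring) -s.g * t.g * hst.fe
          + gg'f hs ht hst hts hz * t.e
      rw [this]
      exact mem hf g_mem hge
    · rw [gg'e'ge hs ht hst hts]; exact mem hg ge_mem (mul_mem he hg)

/-- A word in the generators with two neighbouring indices, in which a generator of the higher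
index is followed by a word of the lower index and a word of the higher index, reduces to a
combination of words in which the higher index occurs only once. -/
theorem mul_mul_mem {x r y : B} (hx : x ∈ ({s.g, s.e, s.h} : Set B)) (hr : r ∈ localSpan F t)
    (hy : y ∈ localSpan F s) : x * r * y ∈ bimoduleSpan R (localSpan F s) := by
  rcases hx with rfl | rfl | rfl
  · exact g_mul_mul_mem hs ht hst hts hz ha hR hr hy
  · exact e_mul_mul_mem hs ht hst hts hz ha hR hr hy
  · have := mul_h_mul_mul_mem hs ht hst hts hz ha hR R.one_mem hr hy
    rwa [one_mul] at this

end Adjacent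

/-! ### The algebra generated by an interval of indices -/

variable {n : ℕ}

/-- The generators whose indices lie in the interval `[p, q)`. -/
def intervalGens (w : Fin n → Strand B) (p q : ℕ) : Set B :=
  {x | ∃ i : Fin n, p ≤ i ∧ (i : ℕ) < q ∧ x ∈ ({(w i).g, (w i).e, (w i).h} : Set B)}

variable (F) in
/-- The subalgebra generated by the generators whose indices lie in the interval `[p, q)`. -/
def intervalAlg (w : Fin n → Strand B) (p q : ℕ) : Subalgebra F B :=
  Algebra.adjoin F (intervalGens w p q)

variable {w : Fin n → Strand B}

theorem intervalAlg_mono {p q r : ℕ} (h : q ≤ r) :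
    intervalAlg F w p q ≤ intervalAlg F w p r :=
  Algebra.adjoin_mono fun _ ⟨i, h1, h2, h3⟩ => ⟨i, h1, h2.trans_le h, h3⟩

/-- The relations of a tied BMW algebra, for a family of generators. -/
structure Tied (c z a : F) (w : Fin n → Strand B) : Prop where
  single : ∀ i, Single c z a (w i)
  adjacent : ∀ i j, Near i j → Adjacent a (w i) (w j)
  far : ∀ i j, Far i j → ∀ x ∈ ({(w i).g, (w i).e, (w i).h} : Set B),
    ∀ y ∈ ({(w j).g, (w j).e, (w j).h} : Set B), x * y = y * x

namespace Tied

variable (hw : Tied c z a w) (hz : z ≠ 0) (ha : a ≠ 0)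
include hw hz ha

theorem localSpan_le_intervalAlg {p q : ℕ} {i : Fin n} (hp : p ≤ i) (hq : (i : ℕ) < q) :
    localSpan F (w i) ≤ Subalgebra.toSubmodule (intervalAlg F w p q) :=
  (hw.single i).localSpan_le hz ha (Algebra.subset_adjoin ⟨i, hp, hq, by simp⟩)
    (Algebra.subset_adjoin ⟨i, hp, hq, by simp⟩) (Algebra.subset_adjoin ⟨i, hp, hq, by simp⟩)

/-- The relations at distant indices concern g, e and h; f is covered as well because the
centralizer is a subalgebra and f is a polynomial in g and e. -/
theorem mul_comm_of_far {p q : ℕ} {i : Fin n} (hi : q < i) {u y : B}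
    (hu : u ∈ intervalAlg F w p q) (hy : y ∈ localSpan F (w i)) : y * u = u * y := by
  have h1 : ∀ x ∈ ({(w i).g, (w i).e, (w i).h} : Set B), Commute x u := fun x hx =>
    Algebra.commute_of_mem_adjoin_of_forall_mem_commute hu fun v ⟨j, _, hj, hv⟩ =>
      hw.far i j (Or.inr (by omega)) x hx v hv
  have h2 : localSpan F (w i) ≤ Subalgebra.toSubmodule (Subalgebra.centralizer F {u}) := by
    refine (hw.single i).localSpan_le hz ha ?_ ?_ ?_ <;>
      rw [Subalgebra.mem_centralizer_iff] <;> rintro _ rfl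
    exacts [(h1 _ (by simp)).symm, (h1 _ (by simp)).symm, (h1 _ (by simp)).symm]
  exact ((Subalgebra.mem_centralizer_iff F).1 (h2 hy) u rfl).symm

/-- Every element of the algebra of an interval is a combination of words in which the highest
index occurs only once. -/
theorem intervalAlg_le_bimoduleSpan {p q : ℕ} (hp : p ≤ q) (hq : q < n) :
    Subalgebra.toSubmodule (intervalAlg F w p (q + 1)) ≤
      bimoduleSpan (intervalAlg F w p q) (localSpan F (w ⟨q, hq⟩)) := by
  induction q, hp using Nat.le_induction with
  | base =>
    -- The interval below the single index p is empty, so the coefficients r and s are scalars and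
    -- the bimodule is just the span of one-index words.
    have hbot : intervalAlg F w p p = ⊥ := by
      have : intervalGens w p p = ∅ :=
        Set.eq_empty_iff_forall_notMem.2 fun x ⟨i, h1, h2, _⟩ => absurd h2 (by omega)
      rw [intervalAlg, this, Algebra.adjoin_empty]
    set M := bimoduleSpan (intervalAlg F w p p) (localSpan F (w ⟨p, hq⟩)) with hM
    have hMQ : ∀ m ∈ M, m ∈ localSpan F (w ⟨p, hq⟩) := by
      intro m hm
      refine bimoduleSpan_induction (P := (· ∈ localSpan F (w ⟨p, hq⟩)))
        (fun u v => add_mem) (fun r hr y hy s hs => ?_) hm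
      rw [hbot, Algebra.mem_bot] at hr hs
      obtain ⟨k, rfl⟩ := hr
      obtain ⟨l, rfl⟩ := hs
      rw [← Algebra.commutes, ← Algebra.smul_def, ← Algebra.smul_def]
      exact Submodule.smul_mem _ _ (Submodule.smul_mem _ _ hy)
    have hQM : ∀ m ∈ localSpan F (w ⟨p, hq⟩), m ∈ M := by
      intro m hm
      have := mul_mul_mem_bimoduleSpan (intervalAlg F w p p).one_mem hm
        (intervalAlg F w p p).one_mem
      rwa [one_mul, mul_one] at this
    have hle : intervalAlg F w p (p + 1) ≤ leftStabilizer M := by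
      refine Algebra.adjoin_le ?_
      rintro x ⟨i, h1, h2, hx⟩ m hm
      obtain rfl : i = ⟨p, hq⟩ := Fin.ext (by simp only; omega)
      exact hQM _ ((hw.single _).mul_mem_localSpan hz ha hx (hMQ m hm))
    intro u hu
    have := hle hu 1 (hQM 1 one_mem)
    rwa [mul_one] at this
  | succ q hpq ih =>
    have hq' : q < n := by omega
    set R := intervalAlg F w p (q + 1) with hRdef
    set M := bimoduleSpan R (localSpan F (w ⟨q + 1, hq⟩)) with hM
    -- Since M contains 1, it is enough that every generator of the larger algebra maps M into
    -- itself from the left.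
    have hle : intervalAlg F w p (q + 1 + 1) ≤ leftStabilizer M := by
      refine Algebra.adjoin_le ?_
      rintro x ⟨i, h1, h2, hx⟩ m hm
      by_cases hi : (i : ℕ) < q + 1
      · have hxR : x ∈ R := Algebra.subset_adjoin ⟨i, h1, hi, hx⟩
        have := mul_mul_mem_bimoduleSpan_of_mem hxR hm R.one_mem
        rwa [mul_one] at this
      obtain rfl : i = ⟨q + 1, hq⟩ := Fin.ext (by simp only; omega)
      refine bimoduleSpan_induction (P := fun m => x * m ∈ M)
        (fun u v h1 h2 => by rw [mul_add]; exact add_mem h1 h2) (fun r hr y hy s hs => ?_) hm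
      refine bimoduleSpan_induction (P := fun r => x * (r * y * s) ∈ M)
        (fun u v h1 h2 => by rw [add_mul, add_mul, mul_add]; exact add_mem h1 h2)
        (fun r₁ hr₁ v hv r₂ hr₂ => ?_) (ih hq' hr)
      have hxQ : x ∈ localSpan F (w ⟨q + 1, hq⟩) := by
        rcases hx with rfl | rfl | rfl
        exacts [g_mem, e_mem, h_mem]
      have hx1 : x * r₁ = r₁ * x := hw.mul_comm_of_far hz ha (by simp) hr₁ hxQ
      have hy2 : y * r₂ = r₂ * y := hw.mul_comm_of_far hz ha (by simp) hr₂ hy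
      -- The induction hypothesis has split r as `r₁ * v * r₂` with v of index q. The outer factors
      -- have indices below q and slide past the letters of index q + 1, leaving the two-index
      -- product `x * v * y`.
      have hre : x * (r₁ * v * r₂ * y * s) = r₁ * (x * v * y) * (r₂ * s) := by
        linear_combination (norm := noncomm_ring) hx1 * v * r₂ * y * s - r₁ * x * v * hy2 * s
      rw [hre]
      have hR : intervalAlg F w p q ≤ R := intervalAlg_mono (by omega)
      refine mul_mul_mem_bimoduleSpan_of_mem (hR hr₁) ?_ (mul_mem (hR hr₂) hs)
      exact mul_mul_mem (hw.single _) (hw.single ⟨q, hq'⟩) (hw.adjacent _ _ (Or.inr rfl))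
        (hw.adjacent _ _ (Or.inl rfl)) hz ha
        (hw.localSpan_le_intervalAlg hz ha (by simpa using hpq) (by simp)) hx hv hy
    intro u hu
    have h1 : (1 : B) ∈ M := by
      have := mul_mul_mem_bimoduleSpan R.one_mem
        (one_mem (F := F) (s := w ⟨q + 1, hq⟩)) R.one_mem
      rwa [one_mul, mul_one] at this
    have := hle hu 1 h1
    rwa [mul_one] at this

end Tied

end Strand

end TiedBMW

/-! ### The tied BMW algebra: interval subalgebras and the index-raising braid. -/

namespace TiedBMW

theorem Far.symm {n : ℕ} {i j : Fin n} (h : Far i j) : Far j i := Or.symm h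

theorem Near.symm {n : ℕ} {i j : Fin n} (h : Near i j) : Near j i := Or.symm h

namespace TBMW

variable {F : Type*} [Field F] (x z a : F) {n : ℕ}

/-- The generators with a given index. -/
def strand (i : Fin n) : Strand (TBMW x z a n) :=
  ⟨g x z a i, gen x z a (TGen.gInv i), e x z a i, h x z a i, f x z a i⟩

theorem mk_rel {r s : FreeAlgebra F (TGen n)} (hrs : TRel x z a n r s) :
    RingQuot.mkAlgHom F (TRel x z a n) r = RingQuot.mkAlgHom F (TRel x z a n) s :=
  RingQuot.mkAlgHom_rel F hrs

theorem single_strand (i : Fin n) : (strand x z a i).Single x⁻¹ z a where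
  g_gi := by simpa only [strand, g, e, h, f, gen, map_mul, map_one] using mk_rel x z a (.g_gInv i)
  gi_g := by simpa only [strand, g, e, h, f, gen, map_mul, map_one] using mk_rel x z a (.gInv_g i)
  hh := by simpa only [strand, g, e, h, f, gen, map_mul, map_smul] using mk_rel x z a (.h_sq i)
  gh := by simpa only [strand, g, e, h, f, gen, map_mul, map_smul] using mk_rel x z a (.gh_self i)
  hg := by simpa only [strand, g, e, h, f, gen, map_mul, map_smul] using mk_rel x z a (.hg_self i)
  ee := by simpa only [strand, g, e, h, f, gen, map_mul] using mk_rel x z a (.e_sq i)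
  eg := by simpa only [strand, g, e, h, f, gen, map_mul] using mk_rel x z a (.eg_self i)
  eh := by simpa only [strand, g, e, h, f, gen, map_mul] using mk_rel x z a (.eh_self i)
  he := by simpa only [strand, g, e, h, f, gen, map_mul] using mk_rel x z a (.he_self i)
  fe := by simpa only [strand, g, e, h, f, gen, map_mul] using mk_rel x z a (.fe_self i)
  ef := by simpa only [strand, g, e, h, f, gen, map_mul] using mk_rel x z a (.ef_self i)
  fg := by simpa only [strand, g, e, h, f, gen, map_mul, map_smul] using mk_rel x z a (.fg_self i)
  gf := by simpa only [strand, g, e, h, f, gen, map_mul, map_smul] using mk_rel x z a (.gf_self i)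
  skein := by simpa only [strand, g, e, h, f, gen, map_add, map_smul] using mk_rel x z a (.skein i)

theorem adjacent_strand (i j : Fin n) (hij : Near i j) :
    (strand x z a i).Adjacent a (strand x z a j) where
  braid := by simpa only [strand, g, e, h, f, gen, map_mul] using mk_rel x z a (.g_braid i j hij)
  hgh := by simpa only [strand, g, e, h, f, gen, map_mul, map_smul] using mk_rel x z a (.hgh i j hij)
  hhh := by simpa only [strand, g, e, h, f, gen, map_mul] using mk_rel x z a (.hhh i j hij)
  ggh := by simpa only [strand, g, e, h, f, gen, map_mul] using mk_rel x z a (.ggh i j hij)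
  hgg := by simpa only [strand, g, e, h, f, gen, map_mul] using mk_rel x z a (.hgg i j hij)
  ghg := by simpa only [strand, g, e, h, f, gen, map_mul] using mk_rel x z a (.ghg i j hij)
  ghh := by simpa only [strand, g, e, h, f, gen, map_mul] using mk_rel x z a (.ghh i j hij)
  hhg := by simpa only [strand, g, e, h, f, gen, map_mul] using mk_rel x z a (.hhg i j hij)
  e_comm := by simpa only [strand, g, e, h, f, gen, map_mul] using mk_rel x z a (.e_comm i j)
  eeg := by simpa only [strand, g, e, h, f, gen, map_mul] using mk_rel x z a (.eeg i j hij)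
  gee := by simpa only [strand, g, e, h, f, gen, map_mul] using mk_rel x z a (.gee i j hij)
  egg := by simpa only [strand, g, e, h, f, gen, map_mul] using mk_rel x z a (.egg i j hij)
  fe := by simpa only [strand, g, e, h, f, gen, map_mul] using mk_rel x z a (.fe_near i j hij)
  ef := by simpa only [strand, g, e, h, f, gen, map_mul] using mk_rel x z a (.ef_near i j hij)
  gfg := by simpa only [strand, g, e, h, f, gen, map_mul] using mk_rel x z a (.gfg i j hij)

theorem tied_strand : Strand.Tied x⁻¹ z a (strand x z a (n := n)) where
  single := single_strand x z a
  adjacent := adjacent_strand x z a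
  far i j hij := by
    rintro _ (rfl | rfl | rfl) _ (rfl | rfl | rfl)
    · simpa only [strand, g, e, h, f, gen, map_mul] using mk_rel x z a (.g_comm i j hij)
    · simpa only [strand, g, e, h, f, gen, map_mul] using (mk_rel x z a (.eg_far j i hij.symm)).symm
    · simpa only [strand, g, e, h, f, gen, map_mul] using mk_rel x z a (.gh_comm i j hij)
    · simpa only [strand, g, e, h, f, gen, map_mul] using mk_rel x z a (.eg_far i j hij)
    · simpa only [strand, g, e, h, f, gen, map_mul] using mk_rel x z a (.e_comm i j)
    · simpa only [strand, g, e, h, f, gen, map_mul] using mk_rel x z a (.eh_far i j hij)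
    · simpa only [strand, g, e, h, f, gen, map_mul] using (mk_rel x z a (.gh_comm j i hij.symm)).symm
    · simpa only [strand, g, e, h, f, gen, map_mul] using (mk_rel x z a (.eh_far j i hij.symm)).symm
    · simpa only [strand, g, e, h, f, gen, map_mul] using mk_rel x z a (.h_comm i j hij)

theorem incl_gen (t : TGen n) : incl x z a n (gen x z a t) = gen x z a t.castSucc := by
  refine (RingQuot.liftAlgHom_mkAlgHom_apply F _ _ _).trans ?_
  rw [AlgHom.comp_apply, FreeAlgebra.lift_ι_apply, gen]

theorem incl_g (i : Fin n) : incl x z a n (g x z a i) = g x z a i.castSucc := incl_gen x z a _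

theorem incl_e (i : Fin n) : incl x z a n (e x z a i) = e x z a i.castSucc := incl_gen x z a _

theorem incl_h (i : Fin n) : incl x z a n (h x z a i) = h x z a i.castSucc := incl_gen x z a _

theorem incl_f (i : Fin n) : incl x z a n (f x z a i) = f x z a i.castSucc := incl_gen x z a _

variable (n) in
/-- The subalgebra generated by the generators whose indices lie in the interval `[p, q)`. -/
abbrev interval (p q : ℕ) : Subalgebra F (TBMW x z a n) :=
  Strand.intervalAlg F (strand x z a (n := n)) p q

theorem map_incl_interval {p q : ℕ} (hq : q ≤ n) :
    (interval x z a n p q).map (incl x z a n) = interval x z a (n + 1) p q := by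
  rw [interval, Strand.intervalAlg, AlgHom.map_adjoin]
  congr 1
  ext y
  constructor
  · rintro ⟨_, ⟨i, h1, h2, rfl | rfl | rfl⟩, rfl⟩
    · exact ⟨i.castSucc, h1, h2, Or.inl (incl_gen x z a _)⟩
    · exact ⟨i.castSucc, h1, h2, Or.inr (Or.inl (incl_gen x z a _))⟩
    · exact ⟨i.castSucc, h1, h2, Or.inr (Or.inr (incl_gen x z a _))⟩
  · rintro ⟨i, h1, h2, hy⟩
    obtain ⟨i, rfl⟩ : ∃ j : Fin n, i = j.castSucc := ⟨⟨i, by omega⟩, rfl⟩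
    rcases hy with rfl | rfl | rfl
    · exact ⟨_, ⟨i, h1, h2, Or.inl rfl⟩, incl_gen x z a _⟩
    · exact ⟨_, ⟨i, h1, h2, Or.inr (Or.inl rfl)⟩, incl_gen x z a _⟩
    · exact ⟨_, ⟨i, h1, h2, Or.inr (Or.inr rfl)⟩, incl_gen x z a _⟩

/-- The algebra is generated by the braid generators, the ties and the tangles. -/
theorem interval_eq_top (hz : z ≠ 0) (ha : a ≠ 0) : interval x z a n 0 n = ⊤ := by
  rw [eq_top_iff]
  have hle : (⊤ : Subalgebra F (FreeAlgebra F (TGen n))) ≤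
      (interval x z a n 0 n).comap (RingQuot.mkAlgHom F (TRel x z a n)) := by
    rw [← FreeAlgebra.adjoin_range_ι]
    refine Algebra.adjoin_le ?_
    rintro _ ⟨t, rfl⟩
    have hQ : ∀ i : Fin n, Strand.localSpan F (strand x z a i) ≤
        Subalgebra.toSubmodule (interval x z a n 0 n) := fun i =>
      (tied_strand x z a).localSpan_le_intervalAlg hz ha (Nat.zero_le _) i.isLt
    cases t with
    | g i => exact hQ i Strand.g_mem
    | gInv i => exact hQ i (single_strand x z a i).gi_mem
    | e i => exact hQ i Strand.e_mem
    | h i => exact hQ i Strand.h_mem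
    | f i => exact hQ i Strand.f_mem
  intro u _
  obtain ⟨v, rfl⟩ := RingQuot.mkAlgHom_surjective F (TRel x z a n) u
  exact hle (Algebra.mem_top (x := v))

/-- The braid in which the last strand crosses all the others. -/
def sweep : ∀ n : ℕ, TBMW x z a n
  | 0 => 1
  | n + 1 => incl x z a n (sweep n) * g x z a (Fin.last n)

/-- The inverse of the braid `sweep`. -/
def sweepInv : ∀ n : ℕ, TBMW x z a n
  | 0 => 1
  | n + 1 => gen x z a (TGen.gInv (Fin.last n)) * incl x z a n (sweepInv n)

theorem sweepInv_mul_sweep (n : ℕ) : sweepInv x z a n * sweep x z a n = 1 := by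
  induction n with
  | zero => exact mul_one 1
  | succ n ih =>
    have h1 : incl x z a n (sweepInv x z a n) * incl x z a n (sweep x z a n) = 1 := by
      rw [← map_mul, ih, map_one]
    have h2 := (single_strand x z a (Fin.last n)).gi_g
    rw [sweep, sweepInv, mul_assoc, ← mul_assoc (incl x z a n _), h1, one_mul]
    exact h2

theorem sweep_mul_sweepInv (n : ℕ) : sweep x z a n * sweepInv x z a n = 1 := by
  induction n with
  | zero => exact mul_one 1
  | succ n ih =>
    have h2 : g x z a (Fin.last n) * gen x z a (TGen.gInv (Fin.last n)) = 1 :=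
      (single_strand x z a (Fin.last n)).g_gi
    rw [sweep, sweepInv, mul_assoc, ← mul_assoc (g x z a _), h2, one_mul, ← map_mul, ih, map_one]

theorem sweep_mem_interval (n : ℕ) : sweep x z a n ∈ interval x z a n 0 n := by
  induction n with
  | zero => exact one_mem _
  | succ n ih =>
    refine mul_mem ?_ (Algebra.subset_adjoin ⟨Fin.last n, by simp, by simp, Or.inl rfl⟩)
    refine Strand.intervalAlg_mono (q := n) (by omega) ?_
    rw [← interval, ← map_incl_interval x z a le_rfl]
    exact ⟨_, ih, rfl⟩

/-- Conjugation by `sweep` raises the index of a generator by one. -/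
theorem sweep_mul (hz : z ≠ 0) (ha : a ≠ 0) (k : ∀ m, Fin m → TBMW x z a m)
    (hincl : ∀ m i, incl x z a m (k m i) = k (m + 1) i.castSucc)
    (hmem : ∀ m i, k m i ∈ ({(strand x z a i).g, (strand x z a i).e, (strand x z a i).h} :
      Set (TBMW x z a m)))
    (hnear : ∀ m i j, Near i j → g x z a i * g x z a j * k m i = k m j * g x z a i * g x z a j)
    (n : ℕ) (i : Fin n) :
    sweep x z a (n + 1) * k (n + 1) i.castSucc = k (n + 1) i.succ * sweep x z a (n + 1) := by
  induction n with
  | zero => exact i.elim0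
  | succ n ih =>
    rw [sweep]
    induction i using Fin.lastCases with
    -- The last two factors of the sweep carry index n to n + 1; the earlier ones have index below n
    -- and commute with the result.
    | last =>
      have h1 : g x z a (Fin.last n).castSucc * g x z a (Fin.last (n + 1)) *
          k (n + 2) (Fin.last n).castSucc = k (n + 2) (Fin.last (n + 1)) *
          g x z a (Fin.last n).castSucc * g x z a (Fin.last (n + 1)) :=
        hnear _ _ _ (Or.inl (by simp))
      have h2 : incl x z a (n + 1) (incl x z a n (sweep x z a n)) ∈ interval x z a (n + 2) 0 n := by
        rw [← map_incl_interval x z a (Nat.le_succ n), ← map_incl_interval x z a le_rfl]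
        exact ⟨_, ⟨_, sweep_mem_interval x z a n, rfl⟩, rfl⟩
      have h3 : k (n + 2) (Fin.last (n + 1)) ∈
          Strand.localSpan F (strand x z a (Fin.last (n + 1))) := by
        rcases hmem (n + 2) (Fin.last (n + 1)) with h | h | h <;> rw [h]
        exacts [Strand.g_mem, Strand.e_mem, Strand.h_mem]
      have h4 := (tied_strand x z a).mul_comm_of_far hz ha (by simp) h2 h3
      rw [sweep, map_mul, incl_g, Fin.succ_last, mul_assoc, mul_assoc, ← mul_assoc (g x z a _), h1,
        mul_assoc (k _ _), ← mul_assoc _ (k _ _), ← h4]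
      simp only [mul_assoc]
    -- Here the index is below n, so the final factor, of index n + 1, commutes with the letter and
    -- the shorter sweep does the work.
    | cast i =>
      have h1 := (tied_strand x z a).far (Fin.last (n + 1)) i.castSucc.castSucc
        (Or.inr (by simp)) (g x z a (Fin.last (n + 1))) (Or.inl rfl) _
        (hmem (n + 2) i.castSucc.castSucc)
      rw [mul_assoc, h1, ← mul_assoc, ← hincl, ← map_mul, ih, map_mul, hincl, mul_assoc,
        Fin.succ_castSucc]

theorem sweep_mul_g (hz : z ≠ 0) (ha : a ≠ 0) (i : Fin n) :
    sweep x z a (n + 1) * g x z a i.castSucc = g x z a i.succ * sweep x z a (n + 1) :=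
  sweep_mul x z a hz ha (fun _ i => g x z a i) (fun _ _ => incl_gen x z a _)
    (fun _ _ => Or.inl rfl) (fun _ i j hij => (adjacent_strand x z a i j hij).braid) n i

theorem sweep_mul_e (hz : z ≠ 0) (ha : a ≠ 0) (i : Fin n) :
    sweep x z a (n + 1) * e x z a i.castSucc = e x z a i.succ * sweep x z a (n + 1) :=
  sweep_mul x z a hz ha (fun _ i => e x z a i) (fun _ _ => incl_gen x z a _)
    (fun _ _ => Or.inr (Or.inl rfl))
    (fun _ i j hij => (adjacent_strand x z a j i hij.symm).egg.symm) n i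

theorem sweep_mul_h (hz : z ≠ 0) (ha : a ≠ 0) (i : Fin n) :
    sweep x z a (n + 1) * h x z a i.castSucc = h x z a i.succ * sweep x z a (n + 1) :=
  sweep_mul x z a hz ha (fun _ i => h x z a i) (fun _ _ => incl_gen x z a _)
    (fun _ _ => Or.inr (Or.inr rfl)) (fun _ i j hij => (adjacent_strand x z a i j hij).ggh) n i

/-- Conjugation by the sweep is multiplicative and linear, so generators decide; the bound on q
ensures that the raised indices still exist. -/
theorem sweep_mul_of_mem_interval (hz : z ≠ 0) (ha : a ≠ 0) {p q : ℕ} (hq : q ≤ n)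
    {u : TBMW x z a (n + 1)} (hu : u ∈ interval x z a (n + 1) p q) :
    ∃ v ∈ interval x z a (n + 1) (p + 1) (q + 1),
      sweep x z a (n + 1) * u = v * sweep x z a (n + 1) := by
  induction hu using Algebra.adjoin_induction with
  | algebraMap r => exact ⟨_, algebraMap_mem _ r, (Algebra.commutes _ _).symm⟩
  | add u₁ u₂ _ _ h₁ h₂ =>
    obtain ⟨v₁, hv₁, h₁⟩ := h₁
    obtain ⟨v₂, hv₂, h₂⟩ := h₂
    exact ⟨_, add_mem hv₁ hv₂, by rw [mul_add, h₁, h₂, add_mul]⟩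
  | mul u₁ u₂ _ _ h₁ h₂ =>
    obtain ⟨v₁, hv₁, h₁⟩ := h₁
    obtain ⟨v₂, hv₂, h₂⟩ := h₂
    exact ⟨_, mul_mem hv₁ hv₂, by rw [← mul_assoc, h₁, mul_assoc, h₂, mul_assoc]⟩
  | mem u hu =>
    obtain ⟨i, h1, h2, hu⟩ := hu
    obtain ⟨i, rfl⟩ : ∃ j : Fin n, i = j.castSucc := ⟨⟨i, by omega⟩, rfl⟩
    rw [Fin.val_castSucc] at h1 h2
    rcases hu with rfl | rfl | rfl
    · exact ⟨_, Algebra.subset_adjoin ⟨i.succ, by simpa, by simpa, Or.inl rfl⟩,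
        sweep_mul_g x z a hz ha i⟩
    · exact ⟨_, Algebra.subset_adjoin ⟨i.succ, by simpa, by simpa, Or.inr (Or.inl rfl)⟩,
        sweep_mul_e x z a hz ha i⟩
    · exact ⟨_, Algebra.subset_adjoin ⟨i.succ, by simpa, by simpa, Or.inr (Or.inr rfl)⟩,
        sweep_mul_h x z a hz ha i⟩

end TBMW

/-! ### Traces: adding a strand, and uniqueness of the tied Markov trace. -/

variable {F : Type*} [Field F] {x z a : F}

section Trace

variable {ω : ∀ n : ℕ, TBMW x z a n →ₗ[F] F}
  (hcomm : ∀ n (u v : TBMW x z a n), ω n (u * v) = ω n (v * u))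
include hcomm

theorem trace_eq_of_sweep_mul_eq {n : ℕ} {u v : TBMW x z a n}
    (h : TBMW.sweep x z a n * u = v * TBMW.sweep x z a n) : ω n u = ω n v := by
  have hu : u = TBMW.sweepInv x z a n * (v * TBMW.sweep x z a n) := by
    rw [← h, ← mul_assoc, TBMW.sweepInv_mul_sweep, one_mul]
  rw [hu, hcomm, mul_assoc, TBMW.sweep_mul_sweepInv, mul_one]

/-- A family of traces on the tied BMW algebras that satisfies Markov conditions for the braid
generators and the tangles and does not see the ties is compatible with the natural maps. -/
theorem trace_incl_of_mem_interval (hz : z ≠ 0) (ha : a ≠ 0) (hone : ∀ n, ω n 1 = 1) {b c : F}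
    (hg : ∀ n (u : TBMW x z a n),
      ω (n + 1) (TBMW.incl x z a n u * TBMW.g x z a (Fin.last n)) = b * ω n u)
    (hh : ∀ n (u : TBMW x z a n),
      ω (n + 1) (TBMW.incl x z a n u * TBMW.h x z a (Fin.last n)) = c * ω n u)
    (he : ∀ n i (u : TBMW x z a n), ω n (u * TBMW.e x z a i) = ω n u)
    (hf : ∀ n i (u : TBMW x z a n), ω n (u * TBMW.f x z a i) = ω n (u * TBMW.h x z a i))
    (l n p : ℕ) (hn : p + l = n) (u : TBMW x z a n) (hu : u ∈ TBMW.interval x z a n p n) :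
    ω (n + 1) (TBMW.incl x z a n u) = ω n u := by
  -- The number l of indices in the interval decreases in both uses below: when the top index is
  -- dropped and when the lowest one is lost through the shift.
  induction l generalizing n p with
  | zero =>
    have : Strand.intervalGens (TBMW.strand x z a (n := n)) p n = ∅ :=
      Set.eq_empty_iff_forall_notMem.2 fun x ⟨i, h1, h2, _⟩ => absurd h2 (by omega)
    rw [TBMW.interval, Strand.intervalAlg, this, Algebra.adjoin_empty, Algebra.mem_bot] at hu
    obtain ⟨k, rfl⟩ := hu
    rw [Algebra.algebraMap_eq_smul_one, map_smul, map_smul, map_smul, map_one, hone, hone]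
  | succ l ih =>
    obtain ⟨m, rfl⟩ : ∃ m, n = m + 1 := ⟨p + l, by omega⟩
    have key : ∀ ρ ∈ TBMW.interval x z a (m + 1) p m,
        ∀ y ∈ Strand.localSpan F (TBMW.strand x z a (Fin.last m)),
          ω (m + 2) (TBMW.incl x z a (m + 1) (ρ * y)) = ω (m + 1) (ρ * y) := by
      intro ρ hρ y hy
      obtain ⟨v, hv, hρv⟩ := TBMW.sweep_mul_of_mem_interval x z a hz ha le_rfl hρ
      have hv_incl := ih (m + 1) (p + 1) (by omega) v hv
      have hρ_trace : ω (m + 1) ρ = ω (m + 1) v := trace_eq_of_sweep_mul_eq hcomm hρv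
      -- The longer sweep has one more letter, of index m + 1, which is far from all indices in ρ.
      -- Hence it shifts the included ρ in the same way as the shorter sweep shifts ρ.
      have hcommute : TBMW.g x z a (Fin.last (m + 1)) * TBMW.incl x z a (m + 1) ρ =
          TBMW.incl x z a (m + 1) ρ * TBMW.g x z a (Fin.last (m + 1)) := by
        refine (TBMW.tied_strand x z a).mul_comm_of_far hz ha (p := p) (q := m)
          (i := Fin.last (m + 1)) (by simp) ?_ Strand.g_mem
        rw [← TBMW.interval, ← TBMW.map_incl_interval x z a (Nat.le_succ m)]
        exact ⟨_, hρ, rfl⟩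
      have hρv' : TBMW.sweep x z a (m + 2) * TBMW.incl x z a (m + 1) ρ =
          TBMW.incl x z a (m + 1) v * TBMW.sweep x z a (m + 2) := by
        rw [TBMW.sweep, mul_assoc, hcommute, ← mul_assoc, ← map_mul, hρv, map_mul, mul_assoc]
      have hρ_incl : ω (m + 2) (TBMW.incl x z a (m + 1) ρ) = ω (m + 1) ρ := by
        rw [trace_eq_of_sweep_mul_eq hcomm hρv', hv_incl, hρ_trace]
      -- A final letter of index m is no longer on top after the inclusion, so no Markov rule
      -- applies to it directly. The shift raises it to index m + 1, the new top.
      have hshift : ∀ (k k' : TBMW x z a (m + 2)),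
          TBMW.sweep x z a (m + 2) * k = k' * TBMW.sweep x z a (m + 2) →
          ω (m + 2) (TBMW.incl x z a (m + 1) ρ * k) =
            ω (m + 2) (TBMW.incl x z a (m + 1) v * k') := fun k k' hk =>
        trace_eq_of_sweep_mul_eq hcomm (by rw [← mul_assoc, hρv', mul_assoc, hk, mul_assoc])
      rw [← TBMW.map_incl_interval x z a le_rfl] at hρ
      obtain ⟨α, hα, rfl⟩ := hρ
      simp only [RingHom.coe_coe] at hρ_incl hρ_trace hshift ⊢
      have hαv : ω (m + 1) v = ω m α := by rw [← hρ_trace]; exact ih m p (by omega) α hα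
      have hg' : ω (m + 2) (TBMW.incl x z a (m + 1)
          (TBMW.incl x z a m α * TBMW.g x z a (Fin.last m))) =
          ω (m + 1) (TBMW.incl x z a m α * TBMW.g x z a (Fin.last m)) := by
        rw [map_mul, TBMW.incl_g, hshift _ _ (TBMW.sweep_mul_g x z a hz ha _), Fin.succ_last, hg,
          hg, hαv]
      have hh' : ω (m + 2) (TBMW.incl x z a (m + 1)
          (TBMW.incl x z a m α * TBMW.h x z a (Fin.last m))) =
          ω (m + 1) (TBMW.incl x z a m α * TBMW.h x z a (Fin.last m)) := by
        rw [map_mul, TBMW.incl_h, hshift _ _ (TBMW.sweep_mul_h x z a hz ha _), Fin.succ_last, hh,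
          hh, hαv]
      have he' : ∀ u : TBMW x z a (m + 1),
          ω (m + 2) (TBMW.incl x z a (m + 1) u) = ω (m + 1) u →
          ω (m + 2) (TBMW.incl x z a (m + 1) (u * TBMW.e x z a (Fin.last m))) =
            ω (m + 1) (u * TBMW.e x z a (Fin.last m)) := fun u hu => by
        rw [map_mul, TBMW.incl_e, he, he, hu]
      induction hy using Submodule.span_induction with
      | zero => simp
      | add u v _ _ h1 h2 => rw [mul_add, map_add, map_add, map_add, h1, h2]
      | smul k u _ h1 => rw [mul_smul_comm, map_smul, map_smul, map_smul, h1]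
      | mem y hy =>
        rcases hy with rfl | rfl | rfl | rfl | rfl | rfl
        · rwa [mul_one]
        · exact hg'
        · exact he' _ hρ_incl
        · exact hh'
        · exact (congrArg (ω (m + 2)) (map_mul _ _ _)).trans
            ((congrArg (fun w => ω (m + 2) (_ * w)) (TBMW.incl_f x z a _)).trans
              ((hf _ _ _).trans ((by rw [map_mul, TBMW.incl_h] at hh'; exact hh' : _ = _).trans
                (hf _ _ _).symm)))
        · rw [← mul_assoc]; exact he' _ hg'
    refine bimoduleSpan_induction (P := fun u => ω (m + 2) (TBMW.incl x z a (m + 1) u) =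
      ω (m + 1) u) (fun u v h1 h2 => by rw [map_add, map_add, map_add, h1, h2])
      (fun r hr y hy s hs => ?_)
      ((TBMW.tied_strand x z a).intervalAlg_le_bimoduleSpan hz ha (by omega) (Nat.lt_succ_self m) hu)
    rw [map_mul, hcomm, hcomm (m + 1), ← map_mul, ← mul_assoc]
    exact key _ (mul_mem hs hr) y hy

end Trace

/-- The normal form and cyclicity reduce to products ρ y. The Markov rules cover y ∈ {g, e, h, f,
ge} and pass to fewer strands. For y = 1 the sweep replaces ρ by an element of the interval from p +
1 to the top, with the number of strands unchanged; this is why the induction runs over interval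
lengths and not over strands. -/
theorem IsTBMWMarkovTrace.eq_on_interval (hz : z ≠ 0) (ha : a ≠ 0)
    {ϖ ϖ' : ∀ n : ℕ, TBMW x z a n →ₗ[F] F} (hϖ : IsTBMWMarkovTrace x z a ϖ)
    (hϖ' : IsTBMWMarkovTrace x z a ϖ') (l n p : ℕ) (hn : p + l = n) (u : TBMW x z a n)
    (hu : u ∈ TBMW.interval x z a n p n) : ϖ n u = ϖ' n u := by
  induction l generalizing n p with
  | zero =>
    have : Strand.intervalGens (TBMW.strand x z a (n := n)) p n = ∅ :=
      Set.eq_empty_iff_forall_notMem.2 fun x ⟨i, h1, h2, _⟩ => absurd h2 (by omega)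
    rw [TBMW.interval, Strand.intervalAlg, this, Algebra.adjoin_empty, Algebra.mem_bot] at hu
    obtain ⟨k, rfl⟩ := hu
    rw [Algebra.algebraMap_eq_smul_one, map_smul, map_smul, hϖ.one, hϖ'.one]
  | succ l ih =>
    obtain ⟨m, rfl⟩ : ∃ m, n = m + 1 := ⟨p + l, by omega⟩
    have key : ∀ ρ ∈ TBMW.interval x z a (m + 1) p m,
        ∀ y ∈ Strand.localSpan F (TBMW.strand x z a (Fin.last m)),
          ϖ (m + 1) (ρ * y) = ϖ' (m + 1) (ρ * y) := by
      intro ρ hρ y hy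
      obtain ⟨v, hv, hρv⟩ := TBMW.sweep_mul_of_mem_interval x z a hz ha le_rfl hρ
      have hone : ϖ (m + 1) ρ = ϖ' (m + 1) ρ := by
        rw [trace_eq_of_sweep_mul_eq hϖ.mul_comm hρv, trace_eq_of_sweep_mul_eq hϖ'.mul_comm hρv]
        exact ih (m + 1) (p + 1) (by omega) v hv
      rw [← TBMW.map_incl_interval x z a le_rfl] at hρ
      obtain ⟨α, hα, rfl⟩ := hρ
      have hα' : ϖ m α = ϖ' m α := ih m p (by omega) α hα
      simp only [RingHom.coe_coe] at hone ⊢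
      induction hy using Submodule.span_induction with
      | zero => simp
      | add u v _ _ h1 h2 => rw [mul_add, map_add, map_add, h1, h2]
      | smul k u _ h1 => rw [mul_smul_comm, map_smul, map_smul, h1]
      | mem y hy =>
        rcases hy with rfl | rfl | rfl | rfl | rfl | rfl
        · rwa [mul_one]
        · exact (hϖ.mul_g m α).trans (hα' ▸ (hϖ'.mul_g m α).symm)
        · exact (hϖ.mul_e m α).trans (hα' ▸ (hϖ'.mul_e m α).symm)
        · exact (hϖ.mul_h m α).trans (hα' ▸ (hϖ'.mul_h m α).symm)
        · exact (hϖ.mul_f m α).trans (hα' ▸ (hϖ'.mul_f m α).symm)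
        · exact (hϖ.mul_g_e m α).trans (hα' ▸ (hϖ'.mul_g_e m α).symm)
    refine bimoduleSpan_induction (P := fun u => ϖ (m + 1) u = ϖ' (m + 1) u)
      (fun u v h1 h2 => by rw [map_add, map_add, h1, h2]) (fun r hr y hy s hs => ?_)
      ((TBMW.tied_strand x z a).intervalAlg_le_bimoduleSpan hz ha (by omega) (Nat.lt_succ_self m) hu)
    rw [hϖ.mul_comm, hϖ'.mul_comm, ← mul_assoc]
    exact key _ (mul_mem hs hr) y hy

/-- There is at most one Markov trace on the tower of tied BMW algebras. -/
theorem IsTBMWMarkovTrace.unique (hz : z ≠ 0) (ha : a ≠ 0)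
    {ϖ ϖ' : ∀ n : ℕ, TBMW x z a n →ₗ[F] F} (hϖ : IsTBMWMarkovTrace x z a ϖ)
    (hϖ' : IsTBMWMarkovTrace x z a ϖ') (n : ℕ) : ϖ n = ϖ' n :=
  LinearMap.ext fun u => hϖ.eq_on_interval hz ha hϖ' n n 0 (Nat.zero_add n) u <| by
    rw [TBMW.interval_eq_top x z a hz ha]; exact Algebra.mem_top

end TiedBMW

/-! ### Deriving the tied relations from the reduced BMW presentation. -/

namespace TiedBMW

namespace Strand

variable {F B : Type*} [Field F] [Ring B] [Algebra F B] {ℓ m : F} {s t : Strand B}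

/-- The defining relations of the BMW algebra between the generators with one index, where the
tie is trivial and the tangle and the tied tangle coincide. -/
structure BMWSingle (ℓ m : F) (s : Strand B) : Prop where
  e_eq : s.e = 1
  f_eq : s.f = s.h
  g_gi : s.g * s.gi = 1
  gi_g : s.gi * s.g = 1
  gh : s.g * s.h = ℓ⁻¹ • s.h
  skein : s.g + s.gi = m • (1 + s.h)

/-- The defining relations of the BMW algebra between the generators with two neighbouring
indices. -/
structure BMWAdjacent (ℓ : F) (s t : Strand B) : Prop where
  braid : s.g * t.g * s.g = t.g * s.g * t.g
  hgh : s.h * t.g * s.h = ℓ • s.h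

namespace BMWSingle

variable (hs : BMWSingle ℓ m s) (hm : m ≠ 0)
include hs

include hm in
theorem h_eq : s.h = m⁻¹ • (s.g + s.gi) - 1 := by
  rw [hs.skein, smul_smul, inv_mul_cancel₀ hm, one_smul]; abel

theorem gi_eq : s.gi = m • 1 + m • s.h - s.g := by
  rw [← smul_add, ← hs.skein]; abel

include hm in
theorem hg : s.h * s.g = ℓ⁻¹ • s.h := by
  rw [← hs.gh, hs.h_eq hm]
  simp only [mul_sub, sub_mul, mul_smul_comm, smul_mul_assoc, mul_add, add_mul, hs.g_gi, hs.gi_g,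
    mul_one, one_mul]

theorem gi_h (hℓ : ℓ ≠ 0) : s.gi * s.h = ℓ • s.h := by
  have h1 : s.gi * (s.g * s.h) = s.h := by rw [← mul_assoc, hs.gi_g, one_mul]
  rw [hs.gh, mul_smul_comm] at h1
  rw [← h1, smul_smul, mul_inv_cancel₀ hℓ, one_smul, h1]

/-- Expand one factor h by the skein relation: g and gi act on the other by ℓ⁻¹ and ℓ. The scalar is
the inverse of the specialized x. -/
theorem hh (hm : m ≠ 0) (hℓ : ℓ ≠ 0) : s.h * s.h = (m⁻¹ * (ℓ + ℓ⁻¹) - 1) • s.h := by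
  nth_rw 1 [hs.h_eq hm]
  rw [sub_mul, smul_mul_assoc, add_mul, hs.gh, hs.gi_h hℓ, one_mul]
  module

theorem gg : s.g * s.g = m • s.g + (m * ℓ⁻¹) • s.h - 1 := by
  have h := congrArg (s.g * ·) hs.skein
  simp only [mul_add, mul_smul_comm, hs.g_gi, hs.gh, mul_one] at h
  linear_combination (norm := module) h

/-- The relations with one index of the tied BMW algebra hold in the BMW algebra. -/
theorem single (hm : m ≠ 0) (hℓ : ℓ ≠ 0) : Single (m⁻¹ * (ℓ + ℓ⁻¹) - 1) m ℓ s where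
  g_gi := hs.g_gi
  gi_g := hs.gi_g
  hh := hs.hh hm hℓ
  gh := hs.gh
  hg := hs.hg hm
  ee := by rw [hs.e_eq, mul_one]
  eg := by rw [hs.e_eq, mul_one, one_mul]
  eh := by rw [hs.e_eq, one_mul]
  he := by rw [hs.e_eq, mul_one]
  fe := by rw [hs.e_eq, mul_one]
  ef := by rw [hs.e_eq, one_mul]
  fg := by rw [hs.f_eq, hs.hg hm]
  gf := by rw [hs.f_eq, hs.gh]
  skein := by rw [hs.e_eq, hs.f_eq, hs.skein]

end BMWSingle

section BMWAdjacent

variable (hs : BMWSingle ℓ m s) (ht : BMWSingle ℓ m t) (hst : BMWAdjacent ℓ s t)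
  (hts : BMWAdjacent ℓ t s) (hm : m ≠ 0)
include hs ht hst hm

/-- By the braid relation, g and gi pass across `s.g * t.g`, and h is a combination of these and 1.
-/
theorem BMWAdjacent.ggh : s.g * t.g * s.h = t.h * s.g * t.g := by
  have h1 : s.g * t.g * s.gi = t.gi * s.g * t.g := by
    linear_combination (norm := noncomm_ring) -ht.gi_g * s.g * t.g * s.gi
      - t.gi * hst.braid * s.gi + t.gi * s.g * t.g * hs.g_gi
  rw [hs.h_eq hm, ht.h_eq hm]
  simp only [mul_sub, sub_mul, mul_smul_comm, smul_mul_assoc, mul_add, add_mul, h1, hst.braid,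
    mul_one, one_mul]

variable (hℓ : ℓ ≠ 0) (hℓm : ℓ⁻¹ ≠ m)
include hts hℓ hℓm

/-- Put W = `t.h * s.g * t.g`. The product `t.h * s.g * W` equals ℓW by `hgh`; writing W as `s.g *
t.g * s.h` and expanding the square of `s.g` gives instead (ℓ + ℓ⁻¹ − m)W + (m − ℓ⁻¹) `t.h * s.h`.
Comparing the two and cancelling ℓ⁻¹ − m finishes. -/
theorem BMWAdjacent.hgg : t.h * s.g * t.g = t.h * s.h := by
  have hW := hst.ggh hs ht hm
  have h1 : t.h * s.g * (t.h * s.g * t.g) = ℓ • (t.h * s.g * t.g) := by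
    have : t.h * s.g * (t.h * s.g * t.g) = t.h * s.g * t.h * (s.g * t.g) := by
      simp only [mul_assoc]
    rw [this, hts.hgh, smul_mul_assoc, mul_assoc]
  have h2 : t.h * s.g * (t.h * s.g * t.g) =
      m • (t.h * s.g * t.g * s.h) + (m * ℓ⁻¹) • (t.h * (s.h * t.g * s.h)) - t.h * t.g * s.h := by
    have : t.h * s.g * (s.g * t.g * s.h) = t.h * (s.g * s.g) * t.g * s.h := by
      simp only [mul_assoc]
    rw [← hW, this, hs.gg, ← mul_assoc t.h (s.h * t.g), ← mul_assoc t.h s.h]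
    rw [hW]
    simp only [mul_sub, sub_mul, mul_smul_comm, smul_mul_assoc, mul_add, add_mul, mul_one]
  have h3 : t.h * s.g * t.g * s.h = (m⁻¹ * (ℓ + ℓ⁻¹) - 1) • (t.h * s.g * t.g) := by
    rw [← hW, mul_assoc, hs.hh hm hℓ, mul_smul_comm]
  rw [h1, h3, hst.hgh, mul_smul_comm, ht.hg hm, smul_mul_assoc] at h2
  have h4 : (ℓ⁻¹ - m) • (t.h * s.g * t.g) = (ℓ⁻¹ - m) • (t.h * s.h) := by
    have h5 : m * (m⁻¹ * (ℓ + ℓ⁻¹) - 1) = ℓ + ℓ⁻¹ - m := by field_simp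
    have h6 : m * ℓ⁻¹ * ℓ = m := by field_simp
    rw [smul_smul, smul_smul, h5, h6] at h2
    linear_combination (norm := module) -h2
  exact smul_right_injective B (sub_ne_zero.2 hℓm) h4

/-- Multiply by `t.g` on the right and expand the squares that appear: every term except `s.h`
cancels. -/
theorem BMWAdjacent.h_mul_inv : s.h * t.g * s.g * s.g = s.h * t.gi := by
  have hgg := hts.hgg ht hs hst hm hℓ hℓm
  have h1 : s.h * t.g * s.g * s.g * t.g = s.h := by
    have e1 : s.h * t.g * s.g * s.g * t.g = s.h * t.g * (s.g * s.g) * t.g := by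
      simp only [mul_assoc]
    have e2 : s.h * t.g * s.g * t.g = ℓ⁻¹ • (s.h * t.h) := by
      have : s.h * t.g * s.g * t.g = s.h * (t.g * s.g * t.g) := by simp only [mul_assoc]
      rw [this, ← hst.braid, ← hgg, ← mul_assoc, ← mul_assoc, hs.hg hm, smul_mul_assoc,
        smul_mul_assoc]
    have e3 : s.h * t.g * t.g = m • (s.h * t.g) + (m * ℓ⁻¹) • (s.h * t.h) - s.h := by
      rw [mul_assoc, ht.gg, mul_sub, mul_add, mul_smul_comm, mul_smul_comm, mul_one]
    rw [e1, hs.gg, mul_sub, mul_add, sub_mul, add_mul, mul_smul_comm, mul_smul_comm,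
      smul_mul_assoc, smul_mul_assoc, e2, hst.hgh, mul_one, e3, smul_mul_assoc]
    match_scalars <;> field_simp <;> ring
  rw [← mul_one (s.h * t.g * s.g * s.g), ← ht.g_gi, ← mul_assoc, h1]

/-- The relations with two neighbouring indices of the tied BMW algebra hold in the BMW algebra. -/
theorem BMWAdjacent.adjacent : Adjacent ℓ s t := by
  have hgg := hst.hgg hs ht hts hm hℓ hℓm
  have hgg' := hts.hgg ht hs hst hm hℓ hℓm
  have hinv := hst.h_mul_inv hs ht hts hm hℓ hℓm
  have hgh' : s.h * t.g * s.g * s.h = s.h := by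
    rw [mul_assoc, hs.gh, mul_smul_comm, hst.hgh, smul_smul, inv_mul_cancel₀ hℓ, one_smul]
  have hgh'' : s.g * t.h = t.gi * (s.h * t.g * s.g) := by
    rw [← hts.ggh ht hs hm, ← mul_assoc, ← mul_assoc, ht.gi_g, one_mul]
  have ghg : s.g * t.h * s.g = t.gi * s.h * t.gi := by
    rw [hgh'', mul_assoc, hinv, mul_assoc]
  exact
    { braid := hst.braid
      hgh := hst.hgh
      hhh := by rw [← hgg', hgh']
      ggh := hst.ggh hs ht hm
      hgg := hgg
      ghg := ghg
      ghh := by rw [hgh'', mul_assoc, hgh']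
      hhg := by rw [← hgg', hinv]
      e_comm := by rw [hs.e_eq, ht.e_eq]
      eeg := by rw [hs.e_eq, ht.e_eq, one_mul, one_mul, mul_one, mul_one]
      gee := by rw [hs.e_eq, ht.e_eq, one_mul, mul_one]
      egg := by rw [hs.e_eq, ht.e_eq, one_mul, mul_one]
      fe := by rw [ht.e_eq, one_mul, mul_one]
      ef := by rw [ht.e_eq, hs.f_eq, one_mul, mul_one]
      gfg := by rw [hs.f_eq, ht.f_eq, ghg] }

end BMWAdjacent

end Strand

namespace BMW

variable {F : Type*} [Field F] (ℓ m : F) {n : ℕ}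

/-- The generators with a given index, completed by a trivial tie. -/
def strand (i : Fin n) : Strand (BMW ℓ m n) :=
  ⟨G ℓ m i, gen ℓ m (Gen.GInv i), 1, H ℓ m i, H ℓ m i⟩

theorem mk_rel {r s : FreeAlgebra F (Gen n)} (hrs : Rel ℓ m n r s) :
    RingQuot.mkAlgHom F (Rel ℓ m n) r = RingQuot.mkAlgHom F (Rel ℓ m n) s :=
  RingQuot.mkAlgHom_rel F hrs

theorem bmwSingle_strand (i : Fin n) : (strand ℓ m i).BMWSingle ℓ m where
  e_eq := rfl
  f_eq := rfl
  g_gi := by simpa only [strand, G, H, gen, map_mul, map_one] using mk_rel ℓ m (.G_GInv i)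
  gi_g := by simpa only [strand, G, H, gen, map_mul, map_one] using mk_rel ℓ m (.GInv_G i)
  gh := by simpa only [strand, G, H, gen, map_mul, map_smul] using mk_rel ℓ m (.GH_self i)
  skein := by
    simpa only [strand, G, H, gen, map_add, map_smul, map_one] using mk_rel ℓ m (.skein i)

theorem bmwAdjacent_strand (i j : Fin n) (hij : Near i j) :
    (strand ℓ m i).BMWAdjacent ℓ (strand ℓ m j) where
  braid := by simpa only [strand, G, H, gen, map_mul] using mk_rel ℓ m (.G_braid i j hij)
  hgh := by simpa only [strand, G, H, gen, map_mul, map_smul] using mk_rel ℓ m (.HGH i j hij)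

theorem G_comm (i j : Fin n) (hij : Far i j) : Commute (G ℓ m i) (G ℓ m j) := by
  show _ = _
  simpa only [G, H, gen, map_mul] using mk_rel ℓ m (.G_comm i j hij)

/-- H is a combination of G, G⁻¹ and 1, which supplies the commutations of H that the reduced
presentation omits. -/
theorem H_comm_of_commute (hm : m ≠ 0) (i : Fin n) {u : BMW ℓ m n} (hu : Commute (G ℓ m i) u) :
    Commute (H ℓ m i) u := by
  have hs := bmwSingle_strand ℓ m i
  have h1 : gen ℓ m (Gen.GInv i) * u = u * gen ℓ m (Gen.GInv i) :=
    inv_mul_eq_mul_inv_of_mul_eq_mul hs.gi_g hs.g_gi hu.symm.eq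
  have h2 : H ℓ m i = m⁻¹ • (G ℓ m i + gen ℓ m (Gen.GInv i)) - 1 := hs.h_eq hm
  rw [h2]
  exact ((hu.add_left h1).smul_left m⁻¹).sub_left (Commute.one_left u)

theorem incl_gen (t : Gen n) : incl ℓ m n (gen ℓ m t) = gen ℓ m t.castSucc := by
  refine (RingQuot.liftAlgHom_mkAlgHom_apply F _ _ _).trans ?_
  rw [AlgHom.comp_apply, FreeAlgebra.lift_ι_apply, gen]

end BMW

/-! ### The homomorphism that forgets ties, and the trace it induces. -/

section Comparison

variable {F : Type*} [Field F] (ℓ m : F) {n : ℕ}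

/-- The images of the generators of the tied BMW algebra in the BMW algebra. -/
def untieGen : TGen n → BMW ℓ m n
  | .g i => BMW.G ℓ m i
  | .gInv i => BMW.gen ℓ m (Gen.GInv i)
  | .e _ => 1
  | .h i => BMW.H ℓ m i
  | .f i => BMW.H ℓ m i

/-- The value of x enters only through the relation for h², where x⁻¹ has to match the scalar in
`BMWSingle.hh`; the condition ℓ⁻¹ ≠ m comes from the cancellation in `BMWAdjacent.hgg`. -/
theorem lift_untieGen_rel (hm : m ≠ 0) (hℓ : ℓ ≠ 0) (hℓm : ℓ⁻¹ ≠ m)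
    {r s : FreeAlgebra F (TGen n)} (hrs : TRel (m / (ℓ + ℓ⁻¹ - m)) m ℓ n r s) :
    FreeAlgebra.lift F (untieGen ℓ m) r = FreeAlgebra.lift F (untieGen ℓ m) s := by
  have hS : ∀ i : Fin n, (BMW.strand ℓ m i).Single (m / (ℓ + ℓ⁻¹ - m))⁻¹ m ℓ := fun i => by
    have : (m / (ℓ + ℓ⁻¹ - m))⁻¹ = m⁻¹ * (ℓ + ℓ⁻¹) - 1 := by
      rw [inv_div, sub_div, div_self hm, div_eq_inv_mul]
    rw [this]
    exact (BMW.bmwSingle_strand ℓ m i).single hm hℓ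
  have hA : ∀ i j : Fin n, Near i j → (BMW.strand ℓ m i).Adjacent ℓ (BMW.strand ℓ m j) :=
    fun i j hij => (BMW.bmwAdjacent_strand ℓ m i j hij).adjacent (BMW.bmwSingle_strand ℓ m i)
      (BMW.bmwSingle_strand ℓ m j) (BMW.bmwAdjacent_strand ℓ m j i hij.symm) hm hℓ hℓm
  have hGG := fun (i j : Fin n) hij => BMW.G_comm ℓ m i j hij
  have hHG := fun (i j : Fin n) hij => BMW.H_comm_of_commute ℓ m hm i (hGG i j hij)
  cases hrs <;> simp only [map_mul, map_add, map_smul, map_one, FreeAlgebra.lift_ι_apply, untieGen]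
  case g_gInv i => exact (hS i).g_gi
  case gInv_g i => exact (hS i).gi_g
  case g_comm i j hij => exact hGG i j hij
  case g_braid i j hij => exact (hA i j hij).braid
  case h_sq i => exact (hS i).hh
  case h_comm i j hij => exact BMW.H_comm_of_commute ℓ m hm i (hHG j i hij.symm).symm
  case gh_comm i j hij => exact (hHG j i hij.symm).symm
  case gh_self i => exact (hS i).gh
  case hg_self i => exact (hS i).hg
  case hgh i j hij => exact (hA i j hij).hgh
  case hhh i j hij => exact (hA i j hij).hhh
  case ggh i j hij => exact (hA i j hij).ggh
  case hgg i j hij => exact (hA i j hij).hgg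
  case ghg i j hij => exact (hA i j hij).ghg
  case ghh i j hij => exact (hA i j hij).ghh
  case hhg i j hij => exact (hA i j hij).hhg
  case eg_self i => exact (hS i).eg
  case eg_far i j hij => rw [one_mul, mul_one]
  case eeg i j hij => exact (hA i j hij).eeg
  case gee i j hij => exact (hA i j hij).gee
  case egg i j hij => exact (hA i j hij).egg
  case e_sq i => exact one_mul 1
  case eh_self i => exact (hS i).eh
  case he_self i => exact (hS i).he
  case eh_far i j hij => rw [one_mul, mul_one]
  case fe_self i => exact (hS i).fe
  case ef_self i => exact (hS i).ef
  case fe_near i j hij => exact (hA i j hij).fe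
  case ef_near i j hij => exact (hA i j hij).ef
  case fg_self i => exact (hS i).fg
  case gf_self i => exact (hS i).gf
  case gfg i j hij => exact (hA i j hij).gfg
  case skein i => exact (hS i).skein

/-- The homomorphism from the tied BMW algebra to the BMW algebra that forgets the ties. -/
def untie (hm : m ≠ 0) (hℓ : ℓ ≠ 0) (hℓm : ℓ⁻¹ ≠ m) (n : ℕ) :
    TBMW (m / (ℓ + ℓ⁻¹ - m)) m ℓ n →ₐ[F] BMW ℓ m n :=
  RingQuot.liftAlgHom F
    ⟨FreeAlgebra.lift F (untieGen ℓ m), fun {_ _} hrs => lift_untieGen_rel ℓ m hm hℓ hℓm hrs⟩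

variable {ℓ m} (hm : m ≠ 0) (hℓ : ℓ ≠ 0) (hℓm : ℓ⁻¹ ≠ m)

theorem untie_gen (t : TGen n) :
    untie ℓ m hm hℓ hℓm n (TBMW.gen _ _ _ t) = untieGen ℓ m t :=
  (RingQuot.liftAlgHom_mkAlgHom_apply F _ _ _).trans (FreeAlgebra.lift_ι_apply _ _)

theorem untie_surjective : Function.Surjective (untie ℓ m hm hℓ hℓm n) := by
  have hle : (⊤ : Subalgebra F (FreeAlgebra F (Gen n))) ≤
      (untie ℓ m hm hℓ hℓm n).range.comap (RingQuot.mkAlgHom F (Rel ℓ m n)) := by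
    rw [← FreeAlgebra.adjoin_range_ι]
    refine Algebra.adjoin_le ?_
    rintro _ ⟨t, rfl⟩
    cases t with
    | G i => exact ⟨_, untie_gen hm hℓ hℓm (TGen.g i)⟩
    | GInv i => exact ⟨_, untie_gen hm hℓ hℓm (TGen.gInv i)⟩
    | H i => exact ⟨_, untie_gen hm hℓ hℓm (TGen.h i)⟩
  intro u
  obtain ⟨v, rfl⟩ := RingQuot.mkAlgHom_surjective F (Rel ℓ m n) u
  exact hle (Algebra.mem_top (x := v))

/-- Homomorphisms on a tied BMW algebra that agree on the braid generators, the ties and the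
tangles are equal. -/
theorem TBMW.algHom_ext {x z a : F} (hz : z ≠ 0) (ha : a ≠ 0) {B : Type*} [Ring B] [Algebra F B]
    {φ φ' : TBMW x z a n →ₐ[F] B} (hg : ∀ i, φ (g x z a i) = φ' (g x z a i))
    (he : ∀ i, φ (e x z a i) = φ' (e x z a i)) (hh : ∀ i, φ (h x z a i) = φ' (h x z a i)) :
    φ = φ' := by
  refine AlgHom.ext_of_adjoin_eq_top (interval_eq_top x z a hz ha) ?_
  rintro _ ⟨i, -, -, rfl | rfl | rfl⟩
  exacts [hg i, he i, hh i]

theorem untie_incl (u : TBMW (m / (ℓ + ℓ⁻¹ - m)) m ℓ n) :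
    untie ℓ m hm hℓ hℓm (n + 1) (TBMW.incl _ _ _ n u) =
      BMW.incl ℓ m n (untie ℓ m hm hℓ hℓm n u) := by
  have key : (untie ℓ m hm hℓ hℓm (n + 1)).comp (TBMW.incl _ _ _ n) =
      (BMW.incl ℓ m n).comp (untie ℓ m hm hℓ hℓm n) := by
    refine TBMW.algHom_ext hm hℓ (fun i => ?_) (fun i => ?_) (fun i => ?_) <;>
      simp only [AlgHom.comp_apply, TBMW.g, TBMW.e, TBMW.h, TBMW.incl_gen, untie_gen, untieGen,
        TGen.castSucc, map_one, BMW.G, BMW.H, BMW.incl_gen, Gen.castSucc]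
  exact DFunLike.congr_fun key u

/-- The Markov trace on the BMW algebras is compatible with the natural maps of the tower. -/
theorem IsBMWMarkovTrace.untie_incl {τ : ∀ n : ℕ, BMW ℓ m n →ₗ[F] F}
    (hτ : IsBMWMarkovTrace ℓ m τ) (u : TBMW (m / (ℓ + ℓ⁻¹ - m)) m ℓ n) :
    τ (n + 1) (untie ℓ m hm hℓ hℓm (n + 1) (TBMW.incl _ _ _ n u)) =
      τ n (untie ℓ m hm hℓ hℓm n u) := by
  -- The normal form is available in the tied algebra, so the argument is run on the pullback of τ,
  -- for which ties are invisible and f cannot be told from h.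
  refine trace_incl_of_mem_interval
    (ω := fun n => τ n ∘ₗ (untie ℓ m hm hℓ hℓm n).toLinearMap)
    (b := m * ℓ / (ℓ + ℓ⁻¹ - m)) (c := m / (ℓ + ℓ⁻¹ - m))
    (fun n u v => ?_) hm hℓ (fun n => ?_) (fun n u => ?_) (fun n u => ?_) (fun n i u => ?_)
    (fun n i u => ?_) n n 0 (Nat.zero_add n) u ?_
  · simp only [LinearMap.comp_apply, AlgHom.toLinearMap_apply, map_mul]
    exact hτ.mul_comm n _ _
  · simp only [LinearMap.comp_apply, AlgHom.toLinearMap_apply, map_one, hτ.one]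
  · simp only [LinearMap.comp_apply, AlgHom.toLinearMap_apply, map_mul, TiedBMW.untie_incl, TBMW.g,
      untie_gen, untieGen, hτ.mul_G]
  · simp only [LinearMap.comp_apply, AlgHom.toLinearMap_apply, map_mul, TiedBMW.untie_incl, TBMW.h,
      untie_gen, untieGen, hτ.mul_H]
  · simp only [LinearMap.comp_apply, AlgHom.toLinearMap_apply, map_mul, TBMW.e, untie_gen,
      untieGen, mul_one]
  · simp only [LinearMap.comp_apply, AlgHom.toLinearMap_apply, map_mul, TBMW.f, TBMW.h, untie_gen,
      untieGen]
  · rw [TBMW.interval_eq_top _ _ _ hm hℓ]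
    exact Algebra.mem_top

/-- The Markov trace on the BMW algebras induces one on the tied BMW algebras. -/
theorem IsBMWMarkovTrace.comp_untie (hd : ℓ + ℓ⁻¹ - m ≠ 0) {τ : ∀ n : ℕ, BMW ℓ m n →ₗ[F] F}
    (hτ : IsBMWMarkovTrace ℓ m τ) :
    IsTBMWMarkovTrace (m / (ℓ + ℓ⁻¹ - m)) m ℓ
      (fun n => τ n ∘ₗ (untie ℓ m hm hℓ hℓm n).toLinearMap) where
  one n := by simp [hτ.one]
  mul_comm n α β := by
    simp only [LinearMap.comp_apply, AlgHom.toLinearMap_apply, map_mul]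
    exact hτ.mul_comm n _ _
  mul_g n α := by
    simp only [LinearMap.comp_apply, AlgHom.toLinearMap_apply, map_mul, TiedBMW.untie_incl, TBMW.g,
      untie_gen, untieGen, hτ.mul_G]
    rw [mul_div_right_comm]
  mul_g_e n α := by
    simp only [LinearMap.comp_apply, AlgHom.toLinearMap_apply, map_mul, TiedBMW.untie_incl, TBMW.g,
      TBMW.e, untie_gen, untieGen, mul_one, hτ.mul_G]
    rw [mul_div_right_comm]
  mul_h n α := by
    simp only [LinearMap.comp_apply, AlgHom.toLinearMap_apply, map_mul, TiedBMW.untie_incl, TBMW.h,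
      untie_gen, untieGen, hτ.mul_H]
  mul_f n α := by
    simp only [LinearMap.comp_apply, AlgHom.toLinearMap_apply, map_mul, TiedBMW.untie_incl, TBMW.f,
      untie_gen, untieGen, hτ.mul_H]
  mul_e n α := by
    -- This is xy = 1. As e maps to 1, the Markov rule for e becomes invariance of τ under adding a
    -- strand.
    have hy : m / (ℓ + ℓ⁻¹ - m) * ((ℓ + ℓ⁻¹) * m⁻¹ - 1) = 1 := by
      rw [← div_eq_mul_inv, div_sub_one hm, div_mul_div_cancel₀ hd, div_self hm]
    have he : untie ℓ m hm hℓ hℓm (n + 1) (TBMW.e _ _ _ (Fin.last n)) = 1 :=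
      untie_gen hm hℓ hℓm _
    simp only [LinearMap.comp_apply, AlgHom.toLinearMap_apply, map_mul, he, mul_one]
    rw [hy, one_mul, hτ.untie_incl hm hℓ hℓm]

end Comparison

/-! ### Nonvanishing of the scalars in ℂ(a, z). -/

theorem zVar_ne_zero : zVar ≠ 0 := by
  rw [zVar, Ne, FaithfulSMul.algebraMap_eq_zero_iff]
  exact MvPolynomial.X_ne_zero 1

theorem aVar_ne_zero : aVar ≠ 0 := by
  rw [aVar, Ne, FaithfulSMul.algebraMap_eq_zero_iff]
  exact MvPolynomial.X_ne_zero 0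

/-- Equality would give the polynomial identity az = 1, which fails at the origin. -/
theorem aVar_inv_ne_zVar : aVar⁻¹ ≠ zVar := by
  intro h
  have h1 : aVar * zVar = 1 := by rw [← h, mul_inv_cancel₀ aVar_ne_zero]
  rw [aVar, zVar, ← map_mul, FaithfulSMul.algebraMap_eq_one_iff] at h1
  simpa using congrArg (MvPolynomial.eval 0) h1

/-- Multiplying by a gives the polynomial a² + 1 − az, whose value at the origin is 1. -/
theorem denominator_ne_zero : aVar + aVar⁻¹ - zVar ≠ 0 := by
  intro h
  have h1 : aVar * aVar + 1 - aVar * zVar = 0 := by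
    have := congrArg (aVar * ·) h
    simpa only [mul_sub, mul_add, mul_inv_cancel₀ aVar_ne_zero, mul_zero] using this
  rw [aVar, zVar, ← map_mul, ← map_mul, ← map_one (algebraMap (MvPolynomial (Fin 2) ℂ) RatFun2),
    ← map_add, ← map_sub, FaithfulSMul.algebraMap_eq_zero_iff] at h1
  simpa using congrArg (MvPolynomial.eval 0) h1

end TiedBMW

theorem mainTheorem9 :
    -- for every number `n + 1 ≥ 1` of strands the prescription on generators defines exactly one
    -- homomorphism, and the maps so defined
    ∃ ψ : ∀ n : ℕ, TiedBMW.KSpec n →ₐ[TiedBMW.RatFun2] TiedBMW.CSpec n,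
      (∀ n, TiedBMW.MapsGenerators (ψ n)) ∧
      (∀ (n : ℕ) (φ : TiedBMW.KSpec n →ₐ[TiedBMW.RatFun2] TiedBMW.CSpec n),
        TiedBMW.MapsGenerators φ → φ = ψ n) ∧
      -- are epimorphisms
      (∀ n, Function.Surjective (ψ n)) ∧
      -- through which the Markov trace `τ` of the BMW algebras induces the Markov trace of the
      -- tied BMW algebras
      (∀ τ : ∀ n : ℕ, TiedBMW.CSpec n →ₗ[TiedBMW.RatFun2] TiedBMW.RatFun2,
        TiedBMW.IsBMWMarkovTrace TiedBMW.aVar TiedBMW.zVar τ →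
          TiedBMW.IsTBMWMarkovTrace TiedBMW.xSpec TiedBMW.zVar TiedBMW.aVar
            (fun n => τ n ∘ₗ (ψ n).toLinearMap) ∧
          ∀ ϖ : ∀ n : ℕ, TiedBMW.KSpec n →ₗ[TiedBMW.RatFun2] TiedBMW.RatFun2,
            TiedBMW.IsTBMWMarkovTrace TiedBMW.xSpec TiedBMW.zVar TiedBMW.aVar ϖ →
              ∀ n, τ n ∘ₗ (ψ n).toLinearMap = ϖ n) := by
  have hz := TiedBMW.zVar_ne_zero
  have ha := TiedBMW.aVar_ne_zero
  have haz := TiedBMW.aVar_inv_ne_zVar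
  have hψ : ∀ n, TiedBMW.MapsGenerators (TiedBMW.untie TiedBMW.aVar TiedBMW.zVar hz ha haz n) :=
    fun n i => ⟨TiedBMW.untie_gen hz ha haz _, TiedBMW.untie_gen hz ha haz _,
      TiedBMW.untie_gen hz ha haz _, TiedBMW.untie_gen hz ha haz _⟩
  refine ⟨TiedBMW.untie TiedBMW.aVar TiedBMW.zVar hz ha haz, hψ, fun n φ hφ => ?_,
    fun n => TiedBMW.untie_surjective hz ha haz, fun τ hτ => ?_⟩
  · exact TiedBMW.TBMW.algHom_ext hz ha
      (fun i => (hφ i).1.trans (hψ n i).1.symm)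
      (fun i => (hφ i).2.1.trans (hψ n i).2.1.symm)
      (fun i => (hφ i).2.2.1.trans (hψ n i).2.2.1.symm)
  · have hτ' := hτ.comp_untie hz ha haz TiedBMW.denominator_ne_zero
    exact ⟨hτ', fun ϖ hϖ n => TiedBMW.IsTBMWMarkovTrace.unique hz ha hτ' hϖ n⟩
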